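/- Let $G$ be a compact connected Lie group, $T\subset G$ a maximal torus and $W=N_G(T)/T$ its Weyl group. Let $Y$ be a path-connected $W$-CW complex of finite type (finitely many $W$-orbits of cells in each dimension) with a base point $y_0$ fixed by $W$. Then $W$ acts on $\pi_1(Y)=\pi_1(Y,y_0)$ by automorphisms; put $\widetilde W=\pi_1(Y)\rtimes W$. Let $\widetilde Y$ be the universal cover of $Y$, on which $\pi_1(Y)$ acts by deck transformations and $W$ acts by the lift of its action on $Y$ that fixes the base point of $\widetilde Y$ over $y_0$; together these give an action of $\widetilde W$ on $\widetilde Y$, and $\widetilde Y$ carries the lifted cell structure. For a compact Lie group $H$ let $R(H)$ be its complex representation ring and $R(H)_{\mathbb Q}=R(H)\otimes\mathbb Q$. Let $\phi\colon\pi_1(Y)\to \operatorname{Hom}(T,\mathbb S^1)$ be a $W$-equivariant homomorphism, where $\operatorname{Hom}(T,\mathbb S^1)$ is the group of continuous homomorphisms, on which $W$ acts through conjugation on $T$. Regarding a character of $T$ as a unit of $R(T)$, let $\widetilde W$ act on $R(T)_{\mathbb Q}$ by $(a,w)\cdot r=\phi(a)\,(w\cdot r)$; this action is linear over $R(G)_{\mathbb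 Q}$, which acts on $R(T)_{\mathbb Q}$ through restriction of representations to $T$. Let $\mathcal R_{\mathbb Q}$ be the coefficient system $\widetilde W/H\mapsto R(T)_{\mathbb Q}^{H}$ on the orbit category of $\widetilde W$, and denote by the same symbol its restriction $\pi_1(Y)/H\mapsto R(T)_{\mathbb Q}^{H}$ to the orbit category of the normal subgroup $\pi_1(Y)$. The group $W$ acts on the Bredon cohomology $H^*_{\pi_1(Y)}(\widetilde Y;\mathcal R_{\mathbb Q})$ by the action induced on cochains by $(w\cdot f)(x)=w\,f(w^{-1}x)$. Then for every $n\ge 0$ there is an isomorphism of $R(G)_{\mathbb Q}$-modules \[ H^{n}_{\widetilde W}(\widetilde Y;\mathcal R_{\mathbb Q})\;\cong\; H^{n}_{\pi_1(Y)}(\widetilde Y;\mathcal R_{\mathbb Q})^{W}. \] -/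

import Mathlib

open CategoryTheory Opposite

noncomputable section

namespace BredonRational

universe u v w

/-! ### Singular chains and the cellular chain groups of a filtered space -/

section Chains

variable {X : Type u} [TopologicalSpace X]

/-- The `i`-th face inclusion `Δⁿ → Δⁿ⁺¹`. -/
def face (n : ℕ) (i : Fin (n + 2)) :
    C(stdSimplex ℝ (Fin (n + 1)), stdSimplex ℝ (Fin (n + 2))) :=
  ⟨stdSimplex.map i.succAbove, stdSimplex.continuous_map _⟩

variable (X) in
/-- Singular `n`-chains of `X` with integral coefficients. -/
abbrev SingChain (n : ℕ) : Type u := C(stdSimplex ℝ (Fin (n + 1)), X) →₀ ℤ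

variable (X) in
/-- The singular boundary `∂ σ = ∑ (-1)ⁱ σ ∘ δᵢ`. -/
def bd (n : ℕ) : SingChain X (n + 1) →+ SingChain X n :=
  ∑ i : Fin (n + 2), ((-1 : ℤ) ^ (i : ℕ)) •
    Finsupp.mapDomain.addMonoidHom (M := ℤ) fun σ => σ.comp (face n i)

lemma face_comp_face {n : ℕ} (i : Fin (n + 2)) (j : Fin (n + 3)) (h : (j : ℕ) ≤ i) :
    (face (n + 1) j).comp (face n i) =
      (face (n + 1) i.succ).comp (face n (j.castLT (lt_of_le_of_lt h i.2))) := by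
  ext1 x
  simp only [face, ContinuousMap.comp_apply, ContinuousMap.coe_mk, stdSimplex.map_comp_apply]
  congr 1
  ext k
  simp only [Function.comp_apply, Fin.succAbove, Fin.lt_def]
  grind

lemma bd_bd (n : ℕ) (c : SingChain X (n + 2)) : bd X n (bd X (n + 1) c) = 0 := by
  suffices h : (bd X n).comp (bd X (n + 1)) = 0 from DFunLike.congr_fun h c
  refine Finsupp.addHom_ext' fun σ => AddMonoidHom.ext_int ?_
  simp only [bd, AddMonoidHom.comp_apply, AddMonoidHom.finsetSum_apply, AddMonoidHom.smul_apply,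
    Finsupp.singleAddHom_apply, Finsupp.mapDomain.addMonoidHom_apply, Finsupp.mapDomain_single,
    map_sum, map_zsmul, AddMonoidHom.zero_apply, Finset.smul_sum, ContinuousMap.comp_assoc]
  rw [← Finset.sum_product']
  let P := Fin (n + 3) × Fin (n + 2)
  let S : Finset P := {ij : P | (ij.1 : ℕ) ≤ (ij.2 : ℕ)}
  rw [Finset.univ_product_univ, ← Finset.sum_add_sum_compl S, ← eq_neg_iff_add_eq_zero,
    ← Finset.sum_neg_distrib]
  refine Finset.sum_bij (fun ij hij => (ij.2.succ,
    Fin.castLT ij.1 (lt_of_le_of_lt (Finset.mem_filter.mp hij).right (Fin.is_lt ij.2)))) ?_ ?_ ?_ ?_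
  · intro ij hij
    simp only [S, Finset.mem_filter_univ, Finset.mem_compl, Fin.val_succ, Fin.val_castLT] at hij ⊢
    lia
  · rintro ⟨i, j⟩ hij ⟨i', j'⟩ hij' h
    have h₁ := congrArg (fun q => (q.1 : ℕ)) h
    have h₂ := congrArg (fun q => (q.2 : ℕ)) h
    simp only [Fin.val_succ, Fin.val_castLT] at h₁ h₂
    exact Prod.ext (Fin.ext h₂) (Fin.ext (by lia))
  · rintro ⟨i', j'⟩ hij'
    simp only [S, Finset.mem_filter_univ, Finset.mem_compl, not_le] at hij'
    refine ⟨(j'.castSucc, i'.pred (by rintro rfl; simp at hij')), ?_, ?_⟩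
    · simp only [S, Finset.mem_filter_univ, Fin.val_castSucc, Fin.val_pred]
      lia
    · simp
  · rintro ⟨i, j⟩ hij
    simp only [S, Finset.mem_filter_univ] at hij
    rw [face_comp_face j i hij]
    simp only [smul_smul, ← neg_smul, Fin.val_succ, Fin.val_castLT]
    congr 1
    ring

/-- The singular `n`-chains of the subspace `B ⊆ X`, as a subgroup of those of `X`. -/
def chainsIn (n : ℕ) (B : Set X) : AddSubgroup (SingChain X n) :=
  AddSubgroup.closure {c | ∃ σ : C(stdSimplex ℝ (Fin (n + 1)), X),
    (∀ p, σ p ∈ B) ∧ c = Finsupp.single σ 1}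

lemma bd_mem {n : ℕ} {B : Set X} {c : SingChain X (n + 1)} (hc : c ∈ chainsIn (n + 1) B) :
    bd X n c ∈ chainsIn n B := by
  have : chainsIn (n + 1) B ≤ (chainsIn n B).comap (bd X n) := by
    refine (AddSubgroup.closure_le _).2 ?_
    rintro _ ⟨σ, hσ, rfl⟩
    simp only [SetLike.mem_coe, AddSubgroup.mem_comap, bd, AddMonoidHom.finsetSum_apply,
      AddMonoidHom.smul_apply, Finsupp.mapDomain.addMonoidHom_apply, Finsupp.mapDomain_single]
    refine AddSubgroup.sum_mem _ fun i _ => AddSubgroup.zsmul_mem _ ?_ _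
    exact AddSubgroup.subset_closure ⟨σ.comp (face n i), fun p => hσ _, rfl⟩
  exact this hc

/-- The map induced on singular chains by a continuous map. -/
def pushChain {X' : Type u} [TopologicalSpace X'] (f : C(X, X')) (n : ℕ) :
    SingChain X n →+ SingChain X' n :=
  Finsupp.mapDomain.addMonoidHom fun σ => f.comp σ

lemma pushChain_bd {X' : Type u} [TopologicalSpace X'] (f : C(X, X')) (n : ℕ)
    (c : SingChain X (n + 1)) : pushChain f n (bd X n c) = bd X' n (pushChain f (n + 1) c) := by
  suffices h : (pushChain f n).comp (bd X n) = (bd X' n).comp (pushChain f (n + 1)) from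
    DFunLike.congr_fun h c
  refine Finsupp.addHom_ext' fun σ => AddMonoidHom.ext_int ?_
  simp only [pushChain, bd, AddMonoidHom.comp_apply, AddMonoidHom.finsetSum_apply,
    AddMonoidHom.smul_apply, Finsupp.singleAddHom_apply, Finsupp.mapDomain.addMonoidHom_apply,
    Finsupp.mapDomain_single, map_sum, map_zsmul, ContinuousMap.comp_assoc]

lemma pushChain_mem {X' : Type u} [TopologicalSpace X'] (f : C(X, X')) {n : ℕ} {B : Set X}
    {B' : Set X'} (h : Set.MapsTo f B B') {c : SingChain X n} (hc : c ∈ chainsIn n B) :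
    pushChain f n c ∈ chainsIn n B' := by
  have : chainsIn n B ≤ (chainsIn n B').comap (pushChain f n) := by
    refine (AddSubgroup.closure_le _).2 ?_
    rintro _ ⟨σ, hσ, rfl⟩
    simp only [SetLike.mem_coe, AddSubgroup.mem_comap, pushChain,
      Finsupp.mapDomain.addMonoidHom_apply, Finsupp.mapDomain_single]
    exact AddSubgroup.subset_closure ⟨_, fun p => h (hσ _), rfl⟩
  exact this hc

lemma pushChain_congr {X' : Type u} [TopologicalSpace X'] (f f' : C(X, X')) {n : ℕ} {B : Set X}
    (h : Set.EqOn f f' B) {c : SingChain X n} (hc : c ∈ chainsIn n B) :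
    pushChain f n c = pushChain f' n c := by
  have : chainsIn n B ≤ (pushChain f n).eqLocus (pushChain f' n) := by
    refine (AddSubgroup.closure_le _).2 ?_
    rintro _ ⟨σ, hσ, rfl⟩
    have : f.comp σ = f'.comp σ := ContinuousMap.ext fun p => h (hσ p)
    change pushChain f n _ = pushChain f' n _
    simp [pushChain, Finsupp.mapDomain_single, this]
  exact this hc

lemma pushChain_id {n : ℕ} (c : SingChain X n) : pushChain (ContinuousMap.id X) n c = c := by
  simp only [pushChain, ContinuousMap.id_comp, Finsupp.mapDomain.addMonoidHom_apply]
  exact Finsupp.mapDomain_id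

lemma pushChain_comp {X' X'' : Type u} [TopologicalSpace X'] [TopologicalSpace X'']
    (g : C(X', X'')) (f : C(X, X')) {n : ℕ} (c : SingChain X n) :
    pushChain (g.comp f) n c = pushChain g n (pushChain f n c) := by
  simp only [pushChain, Finsupp.mapDomain.addMonoidHom_apply, ← Finsupp.mapDomain_comp]
  rfl

/-- Relative singular cycles of the pair `(A (n+1), A n)` in degree `n`. Here and below
`A : ℕ → Set X` is a filtration with `A n` playing the role of the `(n-1)`-skeleton. -/
def relCycles (A : ℕ → Set X) : (n : ℕ) → AddSubgroup (SingChain X n)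
  | 0 => chainsIn 0 (A 1)
  | n + 1 => chainsIn (n + 1) (A (n + 2)) ⊓ (chainsIn n (A (n + 1))).comap (bd X n)

/-- Relative singular boundaries of the pair `(A (n+1), A n)` in degree `n`. -/
def relBoundaries (A : ℕ → Set X) (n : ℕ) : AddSubgroup (SingChain X n) :=
  chainsIn n (A n) ⊔ (chainsIn (n + 1) (A (n + 1))).map (bd X n)

/-- The cellular chain group `H_n(A (n+1), A n; ℤ)`, i.e. `H_n(Xⁿ, Xⁿ⁻¹; ℤ)` when
`A n` is the `(n-1)`-skeleton. -/
abbrev CellChain (A : ℕ → Set X) (n : ℕ) : Type u :=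
  relCycles A n ⧸ (relBoundaries A n).addSubgroupOf (relCycles A n)

lemma relCycles_le (A : ℕ → Set X) (n : ℕ) : relCycles A n ≤ chainsIn n (A (n + 1)) := by
  cases n with
  | zero => exact le_rfl
  | succ n => exact inf_le_left

lemma bd_mem_relCycles (A : ℕ → Set X) (n : ℕ) {c : SingChain X (n + 1)}
    (hc : c ∈ relCycles A (n + 1)) : bd X n c ∈ relCycles A n := by
  cases n with
  | zero => exact hc.2
  | succ n =>
    refine ⟨hc.2, ?_⟩
    change bd X n (bd X (n + 1) c) ∈ chainsIn n (A (n + 1))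
    rw [bd_bd]
    exact zero_mem _

/-- The cellular differential: the connecting map
`H_{n+1}(Xⁿ⁺¹, Xⁿ) → H_n(Xⁿ) → H_n(Xⁿ, Xⁿ⁻¹)`, `[c] ↦ [∂ c]`. -/
def cellD (A : ℕ → Set X) (n : ℕ) : CellChain A (n + 1) →+ CellChain A n :=
  QuotientAddGroup.map _ _
    (((bd X n).comp (relCycles A (n + 1)).subtype).codRestrict (relCycles A n)
      fun c => bd_mem_relCycles A n c.2) <| by
    rintro ⟨c, hc⟩ h
    obtain ⟨s, hs, t, ht, rfl⟩ := AddSubgroup.mem_sup.1 (AddSubgroup.mem_addSubgroupOf.1 h)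
    obtain ⟨e, he, rfl⟩ := ht
    refine AddSubgroup.mem_addSubgroupOf.2 (AddSubgroup.mem_sup_right ?_)
    refine ⟨s, hs, ?_⟩
    change bd X n s = bd X n (s + bd X (n + 1) e)
    rw [map_add, bd_bd, add_zero]

/-- The map on cellular chains induced by a continuous filtration-preserving map. -/
def cellMap {X' : Type u} [TopologicalSpace X'] {A : ℕ → Set X} {A' : ℕ → Set X'} (f : C(X, X'))
    (hf : ∀ m, Set.MapsTo f (A m) (A' m)) (n : ℕ) : CellChain A n →+ CellChain A' n :=
  QuotientAddGroup.map _ _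
    (((pushChain f n).comp (relCycles A n).subtype).codRestrict (relCycles A' n) <| by
      rintro ⟨c, hc⟩
      cases n with
      | zero => exact pushChain_mem f (hf _) hc
      | succ n =>
        refine ⟨pushChain_mem f (hf _) hc.1, ?_⟩
        have := pushChain_mem f (hf _) hc.2
        rwa [pushChain_bd] at this) <| by
    rintro ⟨c, hc⟩ h
    obtain ⟨s, hs, t, ht, rfl⟩ := AddSubgroup.mem_sup.1 (AddSubgroup.mem_addSubgroupOf.1 h)
    obtain ⟨e, he, rfl⟩ := ht
    refine AddSubgroup.mem_addSubgroupOf.2 (AddSubgroup.mem_sup.2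
      ⟨_, pushChain_mem f (hf _) hs, bd X' n (pushChain f (n + 1) e), ?_, ?_⟩)
    · exact ⟨_, pushChain_mem f (hf _) he, rfl⟩
    · change _ = pushChain f n (s + bd X n e)
      rw [map_add, pushChain_bd]

lemma cellMap_mk {X' : Type u} [TopologicalSpace X'] {A : ℕ → Set X} {A' : ℕ → Set X'}
    (f : C(X, X')) (hf : ∀ m, Set.MapsTo f (A m) (A' m)) (n : ℕ) (c : relCycles A n) :
    ∃ h, cellMap f hf n (QuotientAddGroup.mk c) =
      QuotientAddGroup.mk (⟨pushChain f n c, h⟩ : relCycles A' n) :=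
  ⟨_, rfl⟩

lemma cellMap_cellD {X' : Type u} [TopologicalSpace X'] {A : ℕ → Set X} {A' : ℕ → Set X'}
    (f : C(X, X')) (hf : ∀ m, Set.MapsTo f (A m) (A' m)) (n : ℕ) (c : CellChain A (n + 1)) :
    cellMap f hf n (cellD A n c) = cellD A' n (cellMap f hf (n + 1) c) := by
  obtain ⟨c, rfl⟩ := QuotientAddGroup.mk_surjective c
  exact congrArg (QuotientAddGroup.mk (s := (relBoundaries A' n).addSubgroupOf (relCycles A' n)))
    (Subtype.ext (pushChain_bd f n c.1))

lemma cellMap_congr {X' : Type u} [TopologicalSpace X'] {A : ℕ → Set X} {A' : ℕ → Set X'}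
    (f f' : C(X, X')) (hf : ∀ m, Set.MapsTo f (A m) (A' m))
    (hf' : ∀ m, Set.MapsTo f' (A m) (A' m)) (h : ∀ m, Set.EqOn f f' (A m)) (n : ℕ)
    (c : CellChain A n) : cellMap f hf n c = cellMap f' hf' n c := by
  obtain ⟨c, rfl⟩ := QuotientAddGroup.mk_surjective c
  exact congrArg (QuotientAddGroup.mk (s := (relBoundaries A' n).addSubgroupOf (relCycles A' n)))
    (Subtype.ext (pushChain_congr f f' (h (n + 1)) (relCycles_le A n c.2)))

lemma cellMap_id {A : ℕ → Set X} (hf : ∀ m, Set.MapsTo (ContinuousMap.id X) (A m) (A m)) (n : ℕ)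
    (c : CellChain A n) : cellMap (ContinuousMap.id X) hf n c = c := by
  obtain ⟨c, rfl⟩ := QuotientAddGroup.mk_surjective c
  exact congrArg (QuotientAddGroup.mk (s := (relBoundaries A n).addSubgroupOf (relCycles A n)))
    (Subtype.ext (pushChain_id c.1))

lemma cellMap_comp {X' X'' : Type u} [TopologicalSpace X'] [TopologicalSpace X'']
    {A : ℕ → Set X} {A' : ℕ → Set X'} {A'' : ℕ → Set X''} (g : C(X', X'')) (f : C(X, X'))
    (hg : ∀ m, Set.MapsTo g (A' m) (A'' m)) (hf : ∀ m, Set.MapsTo f (A m) (A' m)) (n : ℕ)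
    (c : CellChain A n) :
    cellMap g hg n (cellMap f hf n c) =
      cellMap (g.comp f) (fun m => (hg m).comp (hf m)) n c := by
  obtain ⟨c, rfl⟩ := QuotientAddGroup.mk_surjective c
  exact congrArg (QuotientAddGroup.mk (s := (relBoundaries A'' n).addSubgroupOf (relCycles A'' n)))
    (Subtype.ext (pushChain_comp g f c.1).symm)

lemma cellD_cellD (A : ℕ → Set X) (n : ℕ) (c : CellChain A (n + 2)) :
    cellD A n (cellD A (n + 1) c) = 0 := by
  obtain ⟨c, rfl⟩ := QuotientAddGroup.mk_surjective c
  exact congrArg (QuotientAddGroup.mk (s := (relBoundaries A n).addSubgroupOf (relCycles A n)))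
    (Subtype.ext (bd_bd n c.1))

end Chains

/-! ### The orbit category and Bredon cohomology -/

section Orbit

/-- The orbit category of the discrete group `Γ`: its objects are the orbits `Γ ⧸ H`, its morphisms
are the `Γ`-equivariant maps. -/
structure OrbitCat (Γ : Type v) [Group Γ] where
  /-- The subgroup `H` of the orbit `Γ ⧸ H`. -/
  stab : Subgroup Γ

variable {Γ : Type v} [Group Γ]

instance : Category (OrbitCat Γ) where
  Hom H K := (Γ ⧸ H.stab) →[Γ] (Γ ⧸ K.stab)
  id H := MulActionHom.id Γ
  comp f g := MulActionHom.comp g f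

namespace OrbitCat

/-- The underlying equivariant map of a morphism of the orbit category. -/
def toMap {H K : OrbitCat Γ} (f : H ⟶ K) : (Γ ⧸ H.stab) →[Γ] (Γ ⧸ K.stab) := f

/-- `g` represents `f : Γ ⧸ H → Γ ⧸ K` if `f (H) = g K`. -/
def Represents {H K : OrbitCat Γ} (f : H ⟶ K) (g : Γ) : Prop :=
  toMap f ((1 : Γ) : Γ ⧸ H.stab) = ((g : Γ) : Γ ⧸ K.stab)

/-- A chosen representative of a morphism. -/
def rep {H K : OrbitCat Γ} (f : H ⟶ K) : Γ := (toMap f ((1 : Γ) : Γ ⧸ H.stab)).out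

lemma represents_rep {H K : OrbitCat Γ} (f : H ⟶ K) : Represents f (rep f) :=
  (QuotientGroup.out_eq' _).symm

lemma Represents.conj_mem {H K : OrbitCat Γ} {f : H ⟶ K} {g : Γ} (hg : Represents f g) :
    ∀ h ∈ H.stab, g⁻¹ * h * g ∈ K.stab := by
  intro h hh
  have h1 : toMap f (h • ((1 : Γ) : Γ ⧸ H.stab)) = h • toMap f ((1 : Γ) : Γ ⧸ H.stab) :=
    map_smul _ _ _
  have h2 : h • ((1 : Γ) : Γ ⧸ H.stab) = ((1 : Γ) : Γ ⧸ H.stab) := by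
    change ((h * 1 : Γ) : Γ ⧸ H.stab) = _
    rw [QuotientGroup.eq]
    simpa using hh
  rw [h2, hg] at h1
  have h3 : ((g : Γ) : Γ ⧸ K.stab) = ((h * g : Γ) : Γ ⧸ K.stab) := h1
  simpa [mul_assoc] using QuotientGroup.eq.1 h3

lemma Represents.inv_mul_mem {H K : OrbitCat Γ} {f : H ⟶ K} {g g' : Γ} (hg : Represents f g)
    (hg' : Represents f g') : g⁻¹ * g' ∈ K.stab :=
  QuotientGroup.eq.1 (hg.symm.trans hg')

lemma represents_id (H : OrbitCat Γ) : Represents (𝟙 H) 1 := rfl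

lemma Represents.comp {H K L : OrbitCat Γ} {f : H ⟶ K} {f' : K ⟶ L} {g g' : Γ}
    (hg : Represents f g) (hg' : Represents f' g') : Represents (f ≫ f') (g * g') := by
  change toMap f' (toMap f _) = _
  rw [hg]
  have : ((g : Γ) : Γ ⧸ K.stab) = g • ((1 : Γ) : Γ ⧸ K.stab) := by
    change _ = ((g * 1 : Γ) : Γ ⧸ K.stab)
    rw [mul_one]
  rw [this, map_smul, hg']
  rfl

/-- The morphism `x H ↦ x g K`, defined when `g⁻¹ H g ⊆ K`. -/
def ofRep {H K : OrbitCat Γ} (g : Γ) (hg : ∀ h ∈ H.stab, g⁻¹ * h * g ∈ K.stab) : H ⟶ K :=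
  show (Γ ⧸ H.stab) →[Γ] (Γ ⧸ K.stab) from
  { toFun := Quotient.lift (fun x : Γ => ((x * g : Γ) : Γ ⧸ K.stab)) fun x y hxy => by
      have hxy : x⁻¹ * y ∈ H.stab := QuotientGroup.leftRel_apply.1 hxy
      rw [QuotientGroup.eq]
      simpa [mul_assoc] using hg _ hxy
    map_smul' := by
      intro m x
      obtain ⟨x, rfl⟩ := QuotientGroup.mk_surjective x
      exact congrArg (QuotientGroup.mk (s := K.stab)) (mul_assoc m x g) }

lemma represents_ofRep {H K : OrbitCat Γ} (g : Γ) (hg : ∀ h ∈ H.stab, g⁻¹ * h * g ∈ K.stab) :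
    Represents (ofRep (H := H) (K := K) g hg) g :=
  congrArg (QuotientGroup.mk (s := K.stab)) (one_mul g)

end OrbitCat

/-- The contravariant coefficient system `Γ ⧸ H ↦ V ^ H` of a `Γ`-module `V`; a map
`Γ ⧸ H → Γ ⧸ K`, `H ↦ g K`, induces `V ^ K → V ^ H`, `v ↦ g v`. -/
def fixedCoeff {A : Type w} [CommRing A] {V : Type w} [AddCommGroup V] [Module A V]
    (ρ : Representation A Γ V) : (OrbitCat Γ)ᵒᵖ ⥤ ModuleCat.{w} A where
  obj H := ModuleCat.of A (Representation.invariants (ρ.comp H.unop.stab.subtype))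
  map {K H} f := ModuleCat.ofHom <|
    ((ρ (OrbitCat.rep f.unop)).comp (Submodule.subtype _)).codRestrict _ <| by
      rintro ⟨v, hv⟩ ⟨h, hh⟩
      have h1 := hv ⟨_, (OrbitCat.represents_rep f.unop).conj_mem h hh⟩
      change ρ h (ρ (OrbitCat.rep f.unop) v) = ρ (OrbitCat.rep f.unop) v
      change ρ _ v = v at h1
      conv_rhs => rw [← h1]
      simp only [← Module.End.mul_apply, ← map_mul, Subgroup.subtype_apply]
      congr 2
      group
  map_id H := by
    ext ⟨v, hv⟩
    have h1 := (OrbitCat.represents_id H.unop).inv_mul_mem (OrbitCat.represents_rep (𝟙 H.unop))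
    rw [inv_one, one_mul] at h1
    exact hv ⟨_, h1⟩
  map_comp {L K H} f f' := by
    ext ⟨v, hv⟩
    change ρ (OrbitCat.rep (f'.unop ≫ f.unop)) v =
      ρ (OrbitCat.rep f'.unop) (ρ (OrbitCat.rep f.unop) v)
    have h1 := hv ⟨_, (((OrbitCat.represents_rep f'.unop).comp
      (OrbitCat.represents_rep f.unop)).inv_mul_mem
        (OrbitCat.represents_rep (f'.unop ≫ f.unop)))⟩
    change ρ _ v = v at h1
    conv_rhs => rw [← h1]
    simp only [← Module.End.mul_apply, ← map_mul, Subgroup.subtype_apply]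
    congr 2
    group

lemma fixedCoeff_map {A : Type w} [CommRing A] {V : Type w} [AddCommGroup V] [Module A V]
    (ρ : Representation A Γ V) {H K : OrbitCat Γ} (f : H ⟶ K) {g : Γ}
    (hg : OrbitCat.Represents f g)
    (v : Representation.invariants (ρ.comp K.stab.subtype)) :
    Submodule.subtype (Representation.invariants (ρ.comp H.stab.subtype))
      ((fixedCoeff ρ).map f.op v) = ρ g v := by
  have h1 := v.2 ⟨_, hg.inv_mul_mem (OrbitCat.represents_rep f)⟩
  change ρ _ (v : V) = v at h1
  change ρ (OrbitCat.rep f) (v : V) = _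
  conv_rhs => rw [← h1]
  simp only [← Module.End.mul_apply, ← map_mul, Subgroup.subtype_apply]
  congr 2
  group

end Orbit

section Bredon

variable (Γ : Type v) [Group Γ] (X : Type u) [TopologicalSpace X] [MulAction Γ X]

/-- A filtration of `X` by `Γ`-invariant subspaces; `sk n` is thought of as the `(n-1)`-skeleton
of a `Γ`-CW complex. -/
structure InvFiltration where
  /-- The union of the cells of dimension less than `n`. -/
  sk : ℕ → Set X
  smul_mem : ∀ n (g : Γ) x, x ∈ sk n → g • x ∈ sk n

variable {Γ X}

/-- The filtration of the fixed point space `X ^ H` by the subspaces `(sk n) ^ H`. -/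
def InvFiltration.fixed (F : InvFiltration Γ X) (H : Subgroup Γ) (n : ℕ) : Set X :=
  F.sk n ∩ {x | ∀ h ∈ H, h • x = x}

variable [ContinuousConstSMul Γ X]

variable (X) in
/-- The action of a group element as a continuous map. -/
def smulMap (g : Γ) : C(X, X) := ⟨fun x => g • x, continuous_const_smul g⟩

lemma InvFiltration.mapsTo (F : InvFiltration Γ X) {H K : Subgroup Γ} {g : Γ}
    (hg : ∀ h ∈ H, g⁻¹ * h * g ∈ K) (m : ℕ) :
    Set.MapsTo (smulMap X g) (F.fixed K m) (F.fixed H m) := by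
  rintro x ⟨hx, hx'⟩
  refine ⟨F.smul_mem _ _ _ hx, fun h hh => ?_⟩
  have h1 := congrArg (g • ·) (hx' _ (hg h hh))
  simpa [smul_smul, smulMap, mul_assoc] using h1

/-- The Bredon chain system `Γ ⧸ H ↦ H_n((Xⁿ) ^ H, (Xⁿ⁻¹) ^ H; ℤ)`, on objects. -/
abbrev BredonChain (F : InvFiltration Γ X) (n : ℕ) (H : OrbitCat Γ) : Type u :=
  CellChain (F.fixed H.stab) n

/-- The Bredon chain system on morphisms: `Γ ⧸ H → Γ ⧸ K`, `H ↦ g K`, acts through the map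
`X ^ K → X ^ H`, `x ↦ g x`. -/
def bredonChainMap (F : InvFiltration Γ X) (n : ℕ) {H K : OrbitCat Γ} (f : H ⟶ K) :
    BredonChain F n K →+ BredonChain F n H :=
  cellMap (smulMap X (OrbitCat.rep f)) (F.mapsTo (OrbitCat.represents_rep f).conj_mem) n

lemma bredonChainMap_eq (F : InvFiltration Γ X) (n : ℕ) {H K : OrbitCat Γ} (f : H ⟶ K) {g : Γ}
    (hg : OrbitCat.Represents f g) (c : BredonChain F n K) :
    bredonChainMap F n f c = cellMap (smulMap X g) (F.mapsTo hg.conj_mem) n c := by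
  refine cellMap_congr _ _ _ _ ?_ n c
  rintro m x ⟨-, hx⟩
  have := congrArg (g • ·) (hx _ (hg.inv_mul_mem (OrbitCat.represents_rep f)))
  simpa [smul_smul, smulMap] using this

lemma bredonChainMap_id (F : InvFiltration Γ X) (n : ℕ) (H : OrbitCat Γ) (c : BredonChain F n H) :
    bredonChainMap F n (𝟙 H) c = c := by
  rw [bredonChainMap_eq F n _ (OrbitCat.represents_id H)]
  exact (cellMap_congr _ (ContinuousMap.id X) _ (fun m x hx => hx)
    (fun m x _ => one_smul Γ x) n c).trans (cellMap_id _ n c)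

lemma bredonChainMap_comp (F : InvFiltration Γ X) (n : ℕ) {H K L : OrbitCat Γ} (f : H ⟶ K)
    (f' : K ⟶ L) (c : BredonChain F n L) :
    bredonChainMap F n (f ≫ f') c = bredonChainMap F n f (bredonChainMap F n f' c) := by
  rw [bredonChainMap_eq F n _ ((OrbitCat.represents_rep f).comp (OrbitCat.represents_rep f'))]
  refine Eq.trans ?_ (cellMap_comp _ _ _ _ n c).symm
  exact cellMap_congr _ _ _ _ (fun m x _ => mul_smul _ _ x) n c

variable {A : Type w} [CommRing A]

/-- The Bredon cochains `C^n_Γ(X; M)`: natural transformations from the chain system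
`Γ ⧸ H ↦ H_n((Xⁿ) ^ H, (Xⁿ⁻¹) ^ H; ℤ)` to the coefficient system `M`. -/
def bredonCochains (F : InvFiltration Γ X) (M : (OrbitCat Γ)ᵒᵖ ⥤ ModuleCat.{w} A) (n : ℕ) :
    Submodule A (∀ H : OrbitCat Γ, BredonChain F n H →+ M.obj (op H)) where
  carrier := {η | ∀ (H K : OrbitCat Γ) (f : H ⟶ K) (c : BredonChain F n K),
    η H (bredonChainMap F n f c) = M.map f.op (η K c)}
  zero_mem' H K f c := by simp
  add_mem' {η η'} h h' H K f c := by
    simp [h H K f c, h' H K f c]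
  smul_mem' a η h H K f c := by
    simp [h H K f c]

/-- The `A`-module of Bredon cochains `C^n_Γ(X; M)`. -/
def BredonCochain (F : InvFiltration Γ X) (M : (OrbitCat Γ)ᵒᵖ ⥤ ModuleCat.{w} A) (n : ℕ) :
    Type (max u v w) :=
  bredonCochains F M n

instance (F : InvFiltration Γ X) (M : (OrbitCat Γ)ᵒᵖ ⥤ ModuleCat.{w} A) (n : ℕ) :
    AddCommGroup (BredonCochain F M n) :=
  inferInstanceAs (AddCommGroup (bredonCochains F M n))

instance (F : InvFiltration Γ X) (M : (OrbitCat Γ)ᵒᵖ ⥤ ModuleCat.{w} A) (n : ℕ) :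
    Module A (BredonCochain F M n) :=
  inferInstanceAs (Module A (bredonCochains F M n))

/-- The Bredon coboundary, `η ↦ η ∘ ∂`. -/
def bredonD (F : InvFiltration Γ X) (M : (OrbitCat Γ)ᵒᵖ ⥤ ModuleCat.{w} A) (n : ℕ) :
    BredonCochain F M n →ₗ[A] BredonCochain F M (n + 1) where
  toFun η := ⟨fun H => (η.1 H).comp (cellD (F.fixed H.stab) n), fun H K f c => by
    have := η.2 H K f (cellD (F.fixed K.stab) n c)
    rw [bredonChainMap, cellMap_cellD] at this
    exact this⟩
  map_add' _ _ := rfl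
  map_smul' _ _ := rfl

/-- The Bredon coboundaries in degree `n`. -/
def bredonB (F : InvFiltration Γ X) (M : (OrbitCat Γ)ᵒᵖ ⥤ ModuleCat.{w} A) :
    (n : ℕ) → Submodule A (BredonCochain F M n)
  | 0 => ⊥
  | n + 1 => LinearMap.range (bredonD F M n)

/-- The Bredon cocycles in degree `n`. -/
def bredonZ (F : InvFiltration Γ X) (M : (OrbitCat Γ)ᵒᵖ ⥤ ModuleCat.{w} A) (n : ℕ) :
    Submodule A (BredonCochain F M n) :=
  LinearMap.ker (bredonD F M n)

/-- Bredon cohomology `H^n_Γ(X; M)`. -/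
abbrev BredonH (F : InvFiltration Γ X) (M : (OrbitCat Γ)ᵒᵖ ⥤ ModuleCat.{w} A) (n : ℕ) :=
  bredonZ F M n ⧸ (bredonB F M n).submoduleOf (bredonZ F M n)

lemma bredonB_le_bredonZ (F : InvFiltration Γ X) (M : (OrbitCat Γ)ᵒᵖ ⥤ ModuleCat.{w} A) (n : ℕ) :
    bredonB F M n ≤ bredonZ F M n := by
  cases n with
  | zero => exact bot_le
  | succ n =>
    rintro _ ⟨η, rfl⟩
    refine LinearMap.mem_ker.2 (Subtype.ext (funext fun H => AddMonoidHom.ext fun c => ?_))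
    change η.1 H (cellD _ n (cellD _ (n + 1) c)) = 0
    rw [cellD_cellD, map_zero]

end Bredon

/-! ### The action of the quotient group on the Bredon cohomology of a normal subgroup -/

section Twist

variable {Γ : Type v} [Group Γ] {X : Type u} [TopologicalSpace X] [MulAction Γ X]
  [ContinuousConstSMul Γ X] {A : Type w} [CommRing A] {V : Type w} [AddCommGroup V] [Module A V]

/-- The value of a cochain with coefficients in `Γ ⧸ H ↦ V ^ H`, as an element of `V`. -/
def cochainVal {F : InvFiltration Γ X} {ρ : Representation A Γ V} {n : ℕ}
    (η : BredonCochain F (fixedCoeff ρ) n) (H : OrbitCat Γ) : BredonChain F n H →+ V :=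
  (Submodule.subtype (Representation.invariants (ρ.comp H.stab.subtype))).toAddMonoidHom.comp
    (η.1 H)

lemma cochainVal_smul {F : InvFiltration Γ X} {ρ : Representation A Γ V} {n : ℕ}
    (η : BredonCochain F (fixedCoeff ρ) n) {H K : OrbitCat Γ} (f : H ⟶ K) {g : Γ}
    (hg : OrbitCat.Represents f g) (c : BredonChain F n K) :
    cochainVal η H (cellMap (smulMap X g) (F.mapsTo hg.conj_mem) n c) = ρ g (cochainVal η K c) := by
  rw [← bredonChainMap_eq F n f hg c]
  refine Eq.trans ?_ (fixedCoeff_map ρ f hg (η.1 K c))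
  exact congrArg (Submodule.subtype (Representation.invariants (ρ.comp H.stab.subtype)))
    (η.2 H K f c)

lemma cochain_ext {F : InvFiltration Γ X} {ρ : Representation A Γ V} {n : ℕ}
    {η η' : BredonCochain F (fixedCoeff ρ) n}
    (h : ∀ H c, cochainVal η H c = cochainVal η' H c) : η = η' :=
  Subtype.ext (funext fun H => AddMonoidHom.ext fun c => Subtype.ext (h H c))

lemma cochainVal_congr {F : InvFiltration Γ X} {ρ : Representation A Γ V} {n : ℕ}
    (η : BredonCochain F (fixedCoeff ρ) n) {H H' : OrbitCat Γ} (e : H.stab = H'.stab)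
    {B : ℕ → Set X} (f f' : C(X, X)) (hff' : f = f')
    (hf : ∀ m, Set.MapsTo f (B m) (F.fixed H.stab m))
    (hf' : ∀ m, Set.MapsTo f' (B m) (F.fixed H'.stab m)) (c : CellChain B n) :
    cochainVal η H (cellMap f hf n c) = cochainVal η H' (cellMap f' hf' n c) := by
  cases H; cases H'; cases e; cases hff'; rfl

/-- A symmetry of the pair (`Γ`-space `X`, `Γ`-module `V`) that is compatible with a group
automorphism: `f (g x) = α(g) f(x)` on the space and `t (α(g) v) = g t(v)` on the module. -/
structure Twist (F : InvFiltration Γ X) (ρ : Representation A Γ V) where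
  /-- the group homomorphism -/
  α : Γ →* Γ
  /-- the map of spaces -/
  f : C(X, X)
  /-- the map of modules -/
  t : V →ₗ[A] V
  f_smul : ∀ (g : Γ) x, f (g • x) = α g • f x
  f_mem : ∀ m x, x ∈ F.sk m → f x ∈ F.sk m
  t_smul : ∀ (g : Γ) v, t (ρ (α g) v) = ρ g (t v)

namespace Twist

variable {F : InvFiltration Γ X} {ρ : Representation A Γ V} (τ : Twist F ρ)

/-- The orbit `Γ ⧸ α(H)`. -/
def orb (H : OrbitCat Γ) : OrbitCat Γ := ⟨H.stab.map τ.α⟩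

lemma mapsTo (H : OrbitCat Γ) (m : ℕ) :
    Set.MapsTo τ.f (F.fixed H.stab m) (F.fixed (τ.orb H).stab m) := by
  rintro x ⟨hx, hx'⟩
  refine ⟨τ.f_mem m x hx, ?_⟩
  rintro _ ⟨h, hh, rfl⟩
  rw [← τ.f_smul, hx' h hh]

/-- The map induced on cochains, `(τ η)_H (c) = t (η_{α(H)} (f c))`. -/
def onCochain (n : ℕ) : BredonCochain F (fixedCoeff ρ) n →ₗ[A] BredonCochain F (fixedCoeff ρ) n where
  toFun η := ⟨fun H => AddMonoidHom.codRestrict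
      ((τ.t.toAddMonoidHom.comp (cochainVal η (τ.orb H))).comp (cellMap τ.f (τ.mapsTo H) n))
      (Representation.invariants (ρ.comp H.stab.subtype)) (by
        rintro c ⟨h, hh⟩
        change ρ h (τ.t (cochainVal η (τ.orb H) _)) = τ.t (cochainVal η (τ.orb H) _)
        rw [← τ.t_smul]
        exact congrArg τ.t ((η.1 (τ.orb H) (cellMap τ.f (τ.mapsTo H) n c)).2
          ⟨τ.α h, Subgroup.mem_map_of_mem _ hh⟩)), by
    intro H K f c
    refine Subtype.ext ?_
    refine Eq.trans ?_ (fixedCoeff_map ρ f (OrbitCat.represents_rep f) _).symm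
    change τ.t (cochainVal η (τ.orb H) (cellMap τ.f (τ.mapsTo H) n
        (cellMap (smulMap X (OrbitCat.rep f)) _ n c))) =
      ρ (OrbitCat.rep f) (τ.t (cochainVal η (τ.orb K) (cellMap τ.f (τ.mapsTo K) n c)))
    rw [← τ.t_smul]
    have hg : ∀ h ∈ (τ.orb H).stab,
        (τ.α (OrbitCat.rep f))⁻¹ * h * τ.α (OrbitCat.rep f) ∈ (τ.orb K).stab := by
      rintro _ ⟨h, hh, rfl⟩
      exact ⟨_, (OrbitCat.represents_rep f).conj_mem h hh, by simp⟩
    rw [← cochainVal_smul η (OrbitCat.ofRep _ hg) (OrbitCat.represents_ofRep _ hg), cellMap_comp,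
      cellMap_comp]
    refine congrArg τ.t (cochainVal_congr η rfl _ _ ?_ _ _ c)
    ext x
    exact τ.f_smul _ x⟩
  map_add' η η' := cochain_ext fun H c => map_add τ.t _ _
  map_smul' a η := cochain_ext fun H c => map_smul τ.t a _

lemma cochainVal_onCochain (n : ℕ) (η : BredonCochain F (fixedCoeff ρ) n) (H : OrbitCat Γ)
    (c : BredonChain F n H) :
    cochainVal (τ.onCochain n η) H c =
      τ.t (cochainVal η (τ.orb H) (cellMap τ.f (τ.mapsTo H) n c)) := rfl

lemma onCochain_bredonD (n : ℕ) (η : BredonCochain F (fixedCoeff ρ) n) :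
    τ.onCochain (n + 1) (bredonD F _ n η) = bredonD F _ n (τ.onCochain n η) := by
  refine cochain_ext fun H c => ?_
  change τ.t (cochainVal η (τ.orb H) (cellD _ n (cellMap τ.f (τ.mapsTo H) (n + 1) c))) =
    τ.t (cochainVal η (τ.orb H) (cellMap τ.f (τ.mapsTo H) n (cellD _ n c)))
  rw [cellMap_cellD]

lemma onCochain_mem_bredonZ (n : ℕ) {η : BredonCochain F (fixedCoeff ρ) n}
    (h : η ∈ bredonZ F (fixedCoeff ρ) n) : τ.onCochain n η ∈ bredonZ F (fixedCoeff ρ) n := by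
  have h : bredonD F (fixedCoeff ρ) n η = 0 := h
  change bredonD F (fixedCoeff ρ) n (τ.onCochain n η) = 0
  rw [← onCochain_bredonD, h, map_zero]

lemma onCochain_mem_bredonB (n : ℕ) {η : BredonCochain F (fixedCoeff ρ) n}
    (h : η ∈ bredonB F (fixedCoeff ρ) n) : τ.onCochain n η ∈ bredonB F (fixedCoeff ρ) n := by
  cases n with
  | zero =>
    rw [(Submodule.mem_bot A).1 h, map_zero]
    exact zero_mem _
  | succ n =>
    obtain ⟨ξ, rfl⟩ := h
    exact ⟨τ.onCochain n ξ, (onCochain_bredonD τ n ξ).symm⟩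

/-- The map induced on Bredon cohomology. -/
def onH (n : ℕ) : BredonH F (fixedCoeff ρ) n →ₗ[A] BredonH F (fixedCoeff ρ) n :=
  Submodule.mapQ _ _ ((τ.onCochain n).restrict fun _ h => τ.onCochain_mem_bredonZ n h) <| by
    rintro ⟨η, hη⟩ h
    exact τ.onCochain_mem_bredonB n h

lemma onH_mk (n : ℕ) (η : bredonZ F (fixedCoeff ρ) n) :
    τ.onH n (Submodule.Quotient.mk η) =
      Submodule.Quotient.mk ⟨τ.onCochain n η.1, τ.onCochain_mem_bredonZ n η.2⟩ := rfl

lemma onCochain_of_one (hα : τ.α = MonoidHom.id Γ) (hf : τ.f = ContinuousMap.id X)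
    (ht : τ.t = LinearMap.id) (n : ℕ) (η : BredonCochain F (fixedCoeff ρ) n) :
    τ.onCochain n η = η := by
  refine cochain_ext fun H c => ?_
  rw [cochainVal_onCochain, ht, LinearMap.id_apply]
  refine (cochainVal_congr η (H' := H) ?_ _ _ hf _ (fun m x hx => hx) c).trans ?_
  · simp [orb, hα]
  · exact congrArg _ (cellMap_id _ n c)

lemma onCochain_of_mul (τ₁ τ₂ τ₃ : Twist F ρ) (hα : τ₃.α = τ₂.α.comp τ₁.α)
    (hf : τ₃.f = τ₂.f.comp τ₁.f) (ht : τ₃.t = τ₁.t.comp τ₂.t) (n : ℕ)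
    (η : BredonCochain F (fixedCoeff ρ) n) :
    τ₃.onCochain n η = τ₁.onCochain n (τ₂.onCochain n η) := by
  refine cochain_ext fun H c => ?_
  rw [cochainVal_onCochain, cochainVal_onCochain, cochainVal_onCochain, cellMap_comp, ht,
    LinearMap.comp_apply]
  refine congrArg _ (congrArg _ (cochainVal_congr η ?_ _ _ hf _ _ c))
  simp [orb, hα, Subgroup.map_map]

end Twist

end Twist

section Semidirect

variable {N : Type v} {W : Type w} [Group N] [Group W] {θ : W →* MulAut N} {X : Type u}
  [TopologicalSpace X] [MulAction (N ⋊[θ] W) X] [ContinuousConstSMul (N ⋊[θ] W) X]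
  [MulAction N X] [ContinuousConstSMul N X]
  {A : Type w} [CommRing A] {V : Type w} [AddCommGroup V] [Module A V]

/-- An `N ⋊ W`-invariant filtration is in particular `N`-invariant. The hypothesis says that `N`
acts through its inclusion into `N ⋊ W`. -/
def InvFiltration.res (F : InvFiltration (N ⋊[θ] W) X)
    (hX : ∀ (a : N) (x : X), (SemidirectProduct.inl a : N ⋊[θ] W) • x = a • x) :
    InvFiltration N X where
  sk := F.sk
  smul_mem n a x hx := by
    rw [← hX]
    exact F.smul_mem n _ x hx

variable (F : InvFiltration (N ⋊[θ] W) X)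
  (hX : ∀ (a : N) (x : X), (SemidirectProduct.inl a : N ⋊[θ] W) • x = a • x)
  (ρ : Representation A (N ⋊[θ] W) V)

/-- The symmetry given by `w ∈ W`: it acts on cochains by `(w η)(c) = w η(w⁻¹ c)`. -/
def semidirectTwist (w : W) : Twist (F.res hX) (ρ.comp SemidirectProduct.inl) where
  α := (θ w⁻¹).toMonoidHom
  f := smulMap X (SemidirectProduct.inr w⁻¹ : N ⋊[θ] W)
  t := ρ (SemidirectProduct.inr w)
  f_smul a x := by
    change (SemidirectProduct.inr w⁻¹ : N ⋊[θ] W) • a • x =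
      (θ w⁻¹ a) • (SemidirectProduct.inr w⁻¹ : N ⋊[θ] W) • x
    rw [← hX, ← hX, smul_smul, smul_smul, SemidirectProduct.inl_aut]
    simp [mul_assoc]
  f_mem m x hx := F.smul_mem m _ x hx
  t_smul a v := by
    change ρ (SemidirectProduct.inr w) (ρ (SemidirectProduct.inl (θ w⁻¹ a)) v) =
      ρ (SemidirectProduct.inl a) (ρ (SemidirectProduct.inr w) v)
    simp only [← Module.End.mul_apply, ← map_mul, SemidirectProduct.inl_aut]
    congr 2
    simp [← mul_assoc]

/-- The action of `W = (N ⋊ W) / N` on the Bredon cohomology `H^n_N(X; V^{(-)})`. -/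
def quotientRep (n : ℕ) :
    Representation A W (BredonH (F.res hX) (fixedCoeff (ρ.comp SemidirectProduct.inl)) n) where
  toFun w := (semidirectTwist F hX ρ w).onH n
  map_one' := by
    refine LinearMap.ext fun x => ?_
    obtain ⟨η, rfl⟩ := Submodule.Quotient.mk_surjective _ x
    rw [Twist.onH_mk]
    refine congrArg _ (Subtype.ext (Twist.onCochain_of_one _ ?_ ?_ ?_ n η.1))
    · ext a; simp [semidirectTwist]
    · ext x; simp [semidirectTwist, smulMap]
    · simp [semidirectTwist, Module.End.one_eq_id]
  map_mul' w₁ w₂ := by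
    refine LinearMap.ext fun x => ?_
    obtain ⟨η, rfl⟩ := Submodule.Quotient.mk_surjective _ x
    rw [Module.End.mul_apply, Twist.onH_mk, Twist.onH_mk, Twist.onH_mk]
    refine congrArg _ (Subtype.ext (Twist.onCochain_of_mul _ _ _ ?_ ?_ ?_ n η.1))
    · ext a; simp [semidirectTwist]
    · ext x; simp [semidirectTwist, smulMap, smul_smul]
    · simp [semidirectTwist, Module.End.mul_eq_comp]

end Semidirect

/-! ### The complex representation ring -/

section RepRing

/-- A finite-dimensional continuous complex representation of the topological group `H`, on the
standard vector space of its dimension. -/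
structure ContRep (H : Type w) [Group H] [TopologicalSpace H] where
  /-- the dimension -/
  dim : ℕ
  /-- the representation -/
  rep : Representation ℂ H (Fin dim → ℂ)
  cont : ∀ v, Continuous fun h => rep h v

variable (H : Type w) [Group H] [TopologicalSpace H]

/-- The trivial one-dimensional representation. -/
def ContRep.triv : ContRep H where
  dim := 1
  rep := Representation.trivial ℂ H (Fin 1 → ℂ)
  cont v := by simpa using continuous_const

/-- The relations of the representation ring: isomorphic representations are identified, direct
sums become sums, tensor products become products, the trivial line becomes `1`. -/
inductive RepRel : FreeCommRing (ContRep H) → Prop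
  | iso (U V : ContRep H) (e : U.rep.Equiv V.rep) :
      RepRel (FreeCommRing.of U - FreeCommRing.of V)
  | add (U V S : ContRep H) (e : (U.rep.prod V.rep).Equiv S.rep) :
      RepRel (FreeCommRing.of S - (FreeCommRing.of U + FreeCommRing.of V))
  | mul (U V P : ContRep H) (e : (U.rep.tprod V.rep).Equiv P.rep) :
      RepRel (FreeCommRing.of P - FreeCommRing.of U * FreeCommRing.of V)
  | one : RepRel (FreeCommRing.of (ContRep.triv H) - 1)

/-- The complex representation ring `R(H)`: the Grothendieck ring of the semiring of isomorphism
classes of finite-dimensional continuous complex representations under `⊕` and `⊗`, presented by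
generators and relations. -/
abbrev RepRing : Type w := FreeCommRing (ContRep H) ⧸ Ideal.span {r | RepRel H r}

variable {H}

/-- The class of a representation in the representation ring. -/
def RepRing.cls (U : ContRep H) : RepRing H := Ideal.Quotient.mk _ (FreeCommRing.of U)

lemma RepRing.mk_eq {a b : FreeCommRing (ContRep H)} (h : RepRel H (a - b)) :
    (Ideal.Quotient.mk (Ideal.span {r | RepRel H r}) a) = Ideal.Quotient.mk _ b :=
  Ideal.Quotient.eq.2 (Ideal.subset_span h)

lemma RepRing.cls_iso (U V : ContRep H) (e : U.rep.Equiv V.rep) :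
    RepRing.cls U = RepRing.cls V :=
  RepRing.mk_eq (RepRel.iso U V e)

variable {K L : Type w} [Group K] [TopologicalSpace K] [Group L] [TopologicalSpace L]

/-- Restriction of a representation along a continuous homomorphism. -/
def ContRep.res (f : H →ₜ* K) (U : ContRep K) : ContRep H where
  dim := U.dim
  rep := U.rep.comp (f : H →* K)
  cont v := (U.cont v).comp f.continuous_toFun

/-- An equivalence of representations restricts. -/
def equivRes (f : H →* K) {V V' : Type*} [AddCommGroup V] [Module ℂ V] [AddCommGroup V']
    [Module ℂ V'] {σ : Representation ℂ K V} {σ' : Representation ℂ K V'} (e : σ.Equiv σ') :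
    Representation.Equiv (σ.comp f) (σ'.comp f) :=
  Representation.Equiv.mk e.toLinearEquiv fun g => e.isIntertwining' (f g)

/-- The restriction homomorphism `R(K) → R(H)` along a continuous homomorphism `H → K`. -/
def RepRing.map (f : H →ₜ* K) : RepRing K →+* RepRing H :=
  Ideal.Quotient.lift _ (FreeCommRing.lift fun U => RepRing.cls (U.res f)) <| by
    have : Ideal.span {r | RepRel K r} ≤
        RingHom.ker (FreeCommRing.lift fun U => RepRing.cls (U.res f)) := by
      refine Ideal.span_le.2 ?_
      rintro _ (⟨U, V, e⟩ | ⟨U, V, S, e⟩ | ⟨U, V, P, e⟩ | _) <;>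
        simp only [SetLike.mem_coe, RingHom.mem_ker, map_sub, map_add, map_mul, map_one,
          FreeCommRing.lift_of, sub_eq_zero]
      · exact RepRing.cls_iso _ _ (equivRes (f : H →* K) e)
      · exact RepRing.mk_eq (RepRel.add (U.res f) (V.res f) (S.res f) (equivRes (f : H →* K) e))
      · exact RepRing.mk_eq (RepRel.mul (U.res f) (V.res f) (P.res f) (equivRes (f : H →* K) e))
      · exact RepRing.mk_eq (RepRel.one (H := H))
    exact fun a ha => this ha

lemma RepRing.map_cls (f : H →ₜ* K) (U : ContRep K) :
    RepRing.map f (RepRing.cls U) = RepRing.cls (U.res f) :=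
  (Ideal.Quotient.lift_mk _ _ _).trans (FreeCommRing.lift_of _ _)

lemma RepRing.hom_ext {R : Type*} [CommRing R] {φ ψ : RepRing H →+* R}
    (h : ∀ U, φ (RepRing.cls U) = ψ (RepRing.cls U)) : φ = ψ :=
  Ideal.Quotient.ringHom_ext (FreeCommRing.hom_ext fun U => h U)

lemma RepRing.map_comp (g : K →ₜ* L) (f : H →ₜ* K) :
    RepRing.map (g.comp f) = (RepRing.map f).comp (RepRing.map g) :=
  RepRing.hom_ext fun U => by
    rw [RingHom.comp_apply, RepRing.map_cls, RepRing.map_cls, RepRing.map_cls]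
    rfl

lemma RepRing.map_id : RepRing.map (ContinuousMonoidHom.id H) = RingHom.id (RepRing H) :=
  RepRing.hom_ext fun U => by
    rw [RepRing.map_cls]
    rfl

/-- The one-dimensional representation given by a character `H → S¹`. -/
def ContRep.ofChar (χ : H →ₜ* Circle) : ContRep H where
  dim := 1
  rep :=
    { toFun := fun h => (χ h : ℂ) • LinearMap.id
      map_one' := by simp [Module.End.one_eq_id]
      map_mul' := fun g h => by ext; simp [mul_assoc, mul_left_comm] }
  cont v := by
    have : Continuous fun h => (χ h : ℂ) := continuous_subtype_val.comp χ.continuous_toFun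
    exact this.smul continuous_const

lemma smul_tensor_smul {V V' : Type*} [AddCommGroup V] [Module ℂ V] [AddCommGroup V'] [Module ℂ V']
    (e : TensorProduct ℂ V V ≃ₗ[ℂ] V') (a b : ℂ) :
    e.toLinearMap ∘ₗ TensorProduct.map (a • LinearMap.id) (b • LinearMap.id) =
      ((a * b) • LinearMap.id) ∘ₗ e.toLinearMap := by
  refine TensorProduct.ext' fun x y => ?_
  rw [LinearMap.comp_apply, TensorProduct.map_tmul]
  simp only [LinearMap.smul_apply, LinearMap.id_apply, TensorProduct.smul_tmul_smul,
    LinearMap.comp_apply, LinearEquiv.coe_coe, map_smul]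

/-- The embedding `Hom(H, S¹) → R(H)` of the one-dimensional representations. -/
def RepRing.ofChar : (H →ₜ* Circle) →* RepRing H where
  toFun χ := RepRing.cls (ContRep.ofChar χ)
  map_one' := by
    refine (RepRing.cls_iso (ContRep.ofChar 1) (ContRep.triv H)
      (Representation.Equiv.mk (LinearEquiv.refl ℂ (Fin 1 → ℂ)) ?_)).trans
      (RepRing.mk_eq RepRel.one)
    intro g
    refine LinearMap.ext fun v => ?_
    exact one_smul ℂ v
  map_mul' χ ψ := by
    refine RepRing.mk_eq (RepRel.mul (ContRep.ofChar χ) (ContRep.ofChar ψ) (ContRep.ofChar (χ * ψ))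
      (Representation.Equiv.mk ((TensorProduct.congr (LinearEquiv.funUnique (Fin 1) ℂ ℂ)
        (LinearEquiv.refl ℂ (Fin 1 → ℂ))).trans (TensorProduct.lid ℂ (Fin 1 → ℂ))) ?_))
    exact fun g => smul_tensor_smul _ (χ g : ℂ) (ψ g : ℂ)

lemma RepRing.map_ofChar (f : H →ₜ* K) (χ : K →ₜ* Circle) :
    RepRing.map f (RepRing.ofChar χ) = RepRing.ofChar (χ.comp f) :=
  RepRing.map_cls f _

variable (H) in
/-- The rational representation ring `R(H)_ℚ = ℚ ⊗ R(H)`. -/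
abbrev RepRingQ : Type w := TensorProduct ℤ ℚ (RepRing H)

/-- Restriction on rational representation rings. -/
def RepRingQ.map (f : H →ₜ* K) : RepRingQ K →+* RepRingQ H :=
  (Algebra.TensorProduct.map (AlgHom.id ℤ ℚ) (RepRing.map f).toIntAlgHom).toRingHom

lemma RepRingQ.map_comp (g : K →ₜ* L) (f : H →ₜ* K) (x : RepRingQ L) :
    RepRingQ.map (g.comp f) x = RepRingQ.map f (RepRingQ.map g x) := by
  induction x using TensorProduct.induction_on with
  | zero => simp
  | add x y hx hy => rw [_root_.map_add, _root_.map_add, _root_.map_add, hx, hy]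
  | tmul q r => simp [RepRingQ.map, RepRing.map_comp]

lemma RepRingQ.map_id (x : RepRingQ H) : RepRingQ.map (ContinuousMonoidHom.id H) x = x := by
  induction x using TensorProduct.induction_on with
  | zero => simp
  | add x y hx hy => rw [_root_.map_add, hx, hy]
  | tmul q r => simp [RepRingQ.map, RepRing.map_id]

lemma RepRingQ.map_congr (f f' : H →ₜ* K) (h : RepRing.map f = RepRing.map f') :
    RepRingQ.map f = RepRingQ.map f' := by
  rw [RepRingQ.map, RepRingQ.map, h]

/-- The embedding `Hom(H, S¹) → R(H)_ℚ`. -/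
def RepRingQ.ofChar : (H →ₜ* Circle) →* RepRingQ H :=
  (Algebra.TensorProduct.includeRight (R := ℤ) (A := ℚ) (B := RepRing H)).toRingHom.toMonoidHom.comp
    RepRing.ofChar

lemma RepRingQ.map_ofChar (f : H →ₜ* K) (χ : K →ₜ* Circle) :
    RepRingQ.map f (RepRingQ.ofChar χ) = RepRingQ.ofChar (χ.comp f) := by
  simp [RepRingQ.map, RepRingQ.ofChar, RepRing.map_ofChar]

end RepRing

/-! ### Maximal tori, the Weyl group and its action on `R(T)_ℚ` -/

section Weyl

variable {G : Type w} [Group G] [TopologicalSpace G]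

/-- A torus in a compact Lie group: a closed connected abelian subgroup. -/
def IsTorus (T : Subgroup G) : Prop :=
  IsClosed (T : Set G) ∧ IsConnected (T : Set G) ∧ ∀ s ∈ T, ∀ t ∈ T, s * t = t * s

/-- A maximal torus: a torus which is maximal under inclusion. -/
def IsMaximalTorus (T : Subgroup G) : Prop := Maximal IsTorus T

/-- The Weyl group `W = N_G(T) / T`. -/
abbrev WeylGroup (T : Subgroup G) : Type w :=
  Subgroup.normalizer (T : Set G) ⧸ T.subgroupOf (Subgroup.normalizer (T : Set G))

/-- The inclusion of a subgroup as a continuous homomorphism. -/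
def incl (T : Subgroup G) : T →ₜ* G := ⟨T.subtype, continuous_subtype_val⟩

/-- `R(T)_ℚ` is an `R(G)_ℚ`-module through restriction of representations. -/
instance repModule (T : Subgroup G) : Module (RepRingQ G) (RepRingQ T) :=
  Module.compHom _ (RepRingQ.map (incl T))

lemma repModule_smul (T : Subgroup G) (a : RepRingQ G) (r : RepRingQ T) :
    a • r = RepRingQ.map (incl T) a * r := rfl

variable [IsTopologicalGroup G] (T : Subgroup G)

/-- Conjugation `t ↦ n⁻¹ t n` of `T` by an element of the normalizer. -/
def conjT (n : Subgroup.normalizer (T : Set G)) : T →ₜ* T where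
  toFun t := ⟨(n : G)⁻¹ * t * n, (Subgroup.mem_normalizer_iff''.1 n.2 t).1 t.2⟩
  map_one' := Subtype.ext (by simp)
  map_mul' s t := Subtype.ext (by simp [mul_assoc])
  continuous_toFun := by
    refine Continuous.subtype_mk ?_ _
    fun_prop

lemma conjT_mul (n m : Subgroup.normalizer (T : Set G)) :
    conjT T (n * m) = (conjT T m).comp (conjT T n) := by
  refine ContinuousMonoidHom.ext fun t => Subtype.ext ?_
  change ((n * m : Subgroup.normalizer (T : Set G)) : G)⁻¹ * t *
    (n * m : Subgroup.normalizer (T : Set G)) = (m : G)⁻¹ * ((n : G)⁻¹ * t * n) * m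
  simp [mul_assoc]

lemma conjT_one : conjT T 1 = ContinuousMonoidHom.id T := by
  refine ContinuousMonoidHom.ext fun t => Subtype.ext ?_
  change ((1 : Subgroup.normalizer (T : Set G)) : G)⁻¹ * t *
    (1 : Subgroup.normalizer (T : Set G)) = t
  simp

/-- The action of the Weyl group on `Hom(T, S¹)`: `(w χ)(t) = χ(n⁻¹ t n)` for `w = [n]`. -/
def weylChar : WeylGroup T →* Monoid.End (T →ₜ* Circle) :=
  QuotientGroup.lift _
    { toFun := fun n =>
        { toFun := fun χ => χ.comp (conjT T n)
          map_one' := rfl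
          map_mul' := fun _ _ => rfl }
      map_one' := MonoidHom.ext fun χ => by
        change χ.comp (conjT T 1) = χ
        rw [conjT_one]
        rfl
      map_mul' := fun n m => MonoidHom.ext fun χ => by
        change χ.comp (conjT T (n * m)) = (χ.comp (conjT T m)).comp (conjT T n)
        rw [conjT_mul]
        rfl } <| by
    intro n hn
    rw [MonoidHom.mem_ker]
    ext χ t
    have h : conjT T n t = (⟨n, hn⟩ : T)⁻¹ * t * ⟨n, hn⟩ := Subtype.ext rfl
    change ((χ (conjT T n t) : Circle) : ℂ) = χ t
    rw [h, map_mul, map_mul, map_inv, mul_right_comm, inv_mul_cancel, one_mul]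

/-- Conjugation by an element of a group gives an isomorphic representation. -/
lemma cls_conj {H : Type w} [Group H] [TopologicalSpace H] (U : ContRep G) (f f' : H →ₜ* G) (g : G)
    (h : ∀ x, f' x = g⁻¹ * f x * g) : RepRing.cls (U.res f') = RepRing.cls (U.res f) := by
  have h₁ : U.rep g ∘ₗ U.rep g⁻¹ = LinearMap.id := by
    rw [← Module.End.mul_eq_comp, ← map_mul, mul_inv_cancel, map_one]; rfl
  have h₂ : U.rep g⁻¹ ∘ₗ U.rep g = LinearMap.id := by
    rw [← Module.End.mul_eq_comp, ← map_mul, inv_mul_cancel, map_one]; rfl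
  refine RepRing.cls_iso _ _ (Representation.Equiv.mk
    (LinearEquiv.ofLinearMap (U.rep g) (U.rep g⁻¹) h₁ h₂) fun x => ?_)
  change U.rep g * U.rep (f' x) = U.rep (f x) * U.rep g
  rw [← map_mul, ← map_mul, h]
  congr 1
  group

lemma map_conjT_incl (n : Subgroup.normalizer (T : Set G)) (a : RepRingQ G) :
    RepRingQ.map (conjT T n) (RepRingQ.map (incl T) a) = RepRingQ.map (incl T) a := by
  rw [← RepRingQ.map_comp]
  refine DFunLike.congr_fun (RepRingQ.map_congr _ _ (RepRing.hom_ext fun U => ?_)) a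
  rw [RepRing.map_cls, RepRing.map_cls]
  exact cls_conj U _ _ (n : G) fun x => rfl

/-- The action of the Weyl group on `R(T)_ℚ`, induced by conjugation of `T`; it is linear over
`R(G)_ℚ`. -/
def weylRep : Representation (RepRingQ G) (WeylGroup T) (RepRingQ T) :=
  QuotientGroup.lift _
    { toFun := fun n =>
        { toFun := RepRingQ.map (conjT T n)
          map_add' := map_add _
          map_smul' := fun a r => by
            rw [RingHom.id_apply, repModule_smul, repModule_smul, map_mul, map_conjT_incl] }
      map_one' := LinearMap.ext fun r => by
        change RepRingQ.map (conjT T 1) r = r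
        rw [conjT_one, RepRingQ.map_id]
      map_mul' := fun n m => LinearMap.ext fun r => by
        change RepRingQ.map (conjT T (n * m)) r = RepRingQ.map (conjT T n) (RepRingQ.map (conjT T m) r)
        rw [conjT_mul, RepRingQ.map_comp] } <| by
    intro n hn
    rw [MonoidHom.mem_ker]
    refine LinearMap.ext fun r => ?_
    change RepRingQ.map (conjT T n) r = r
    rw [RepRingQ.map_congr (conjT T n) (ContinuousMonoidHom.id T), RepRingQ.map_id]
    refine RepRing.hom_ext fun U => ?_
    rw [RepRing.map_cls, RepRing.map_cls]
    exact cls_conj U _ _ (⟨n, hn⟩ : T) fun x => Subtype.ext rfl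

lemma weylRep_char_mul (w : WeylGroup T) (χ : T →ₜ* Circle) (r : RepRingQ T) :
    weylRep T w (RepRingQ.ofChar χ * r) = RepRingQ.ofChar (weylChar T w χ) * weylRep T w r := by
  obtain ⟨n, rfl⟩ := QuotientGroup.mk_surjective w
  change RepRingQ.map (conjT T n) _ = RepRingQ.ofChar (χ.comp (conjT T n)) * RepRingQ.map (conjT T n) r
  rw [map_mul, RepRingQ.map_ofChar]

/-- Given a group `P` with a `W`-action `θ` and a `W`-equivariant homomorphism
`φ : P → Hom(T, S¹)`, the group `P ⋊ W` acts on `R(T)_ℚ` by `(a, w) r = φ(a) · (w r)`. -/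
def twistedRep {P : Type v} [Group P] (θ : WeylGroup T →* MulAut P) (φ : P →* (T →ₜ* Circle))
    (hφ : ∀ w a, φ (θ w a) = weylChar T w (φ a)) :
    Representation (RepRingQ G) (P ⋊[θ] WeylGroup T) (RepRingQ T) where
  toFun x :=
    { toFun := fun r => RepRingQ.ofChar (φ x.left) * weylRep T x.right r
      map_add' := fun r s => by rw [map_add, mul_add]
      map_smul' := fun a r => by
        rw [map_smul, RingHom.id_apply, repModule_smul, repModule_smul, mul_left_comm] }
  map_one' := LinearMap.ext fun r => by simp
  map_mul' x y := LinearMap.ext fun r => by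
    change RepRingQ.ofChar (φ (x.left * θ x.right y.left)) * weylRep T (x.right * y.right) r =
      RepRingQ.ofChar (φ x.left) * weylRep T x.right
        (RepRingQ.ofChar (φ y.left) * weylRep T y.right r)
    rw [weylRep_char_mul, map_mul, map_mul, hφ, map_mul, Module.End.mul_apply, mul_assoc]

end Weyl

/-! ### The universal cover and its action of `π₁(Y) ⋊ W` -/

section Cover

variable {Y : Type u} [TopologicalSpace Y]

/-- The fundamental group with the convention that `a * b` is the loop `a` followed by the loop `b`;
Mathlib's `FundamentalGroup` multiplies in the opposite order. -/
abbrev PiOne (y₀ : Y) : Type u := (FundamentalGroup Y y₀)ᵐᵒᵖ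

/-- The homotopy class of loops underlying an element of the fundamental group. -/
def PiOne.loop {y₀ : Y} (a : PiOne y₀) : Path.Homotopic.Quotient y₀ y₀ :=
  FundamentalGroup.toPath a.unop

/-- The universal cover of the path-connected space `Y`: homotopy classes (relative to end points)
of paths starting at the base point `y₀`; the covering projection is `pt`. -/
@[ext]
structure UnivCover (y₀ : Y) where
  /-- the end point, i.e. the image under the covering projection -/
  pt : Y
  /-- the homotopy class of paths -/
  cls : Path.Homotopic.Quotient y₀ pt

namespace UnivCover

variable {y₀ : Y}

/-- The set of all `[γ · η]` where `x = [γ]` and `η` is a path in `U`. -/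
def whisker (x : UnivCover y₀) (U : Set Y) : Set (UnivCover y₀) :=
  {z | ∃ η : Path x.pt z.pt, (∀ t, η t ∈ U) ∧
    z.cls = x.cls.trans (Path.Homotopic.Quotient.mk η)}

/-- The usual topology of the universal cover: the sets `whisker x U`, for `U` an open
neighbourhood of the end point of `x`, form a basis. -/
instance : TopologicalSpace (UnivCover y₀) :=
  TopologicalSpace.generateFrom {S | ∃ (x : UnivCover y₀) (U : Set Y),
    IsOpen U ∧ x.pt ∈ U ∧ S = whisker x U}

lemma mk_eq {y y' : Y} (p : Path y₀ y) (p' : Path y₀ y') (h : ∀ t, p t = p' t) :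
    (⟨y, Path.Homotopic.Quotient.mk p⟩ : UnivCover y₀) =
      ⟨y', Path.Homotopic.Quotient.mk p'⟩ := by
  have hy : y = y' := by rw [← p.target, ← p'.target, h]
  subst hy
  have : p = p' := Path.ext (funext h)
  rw [this]

/-- The action of the fundamental group by deck transformations, `a [γ] = [a · γ]`. -/
instance : MulAction (PiOne y₀) (UnivCover y₀) where
  smul a x := ⟨x.pt, a.loop.trans x.cls⟩
  one_smul x := by
    obtain ⟨y, γ⟩ := x
    exact congrArg (UnivCover.mk y) (Path.Homotopic.Quotient.refl_trans γ)
  mul_smul a b x := by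
    obtain ⟨y, γ⟩ := x
    exact congrArg (UnivCover.mk y) (Path.Homotopic.Quotient.trans_assoc a.loop b.loop γ)

lemma smul_def (a : PiOne y₀) (x : UnivCover y₀) : a • x = ⟨x.pt, a.loop.trans x.cls⟩ := rfl

lemma smul_mem_whisker (a : PiOne y₀) {x z : UnivCover y₀} {U : Set Y} (h : z ∈ whisker x U) :
    a • z ∈ whisker (a • x) U := by
  obtain ⟨η, hη, hz⟩ := h
  refine ⟨η, hη, ?_⟩
  change a.loop.trans z.cls = (a.loop.trans x.cls).trans _
  rw [hz, Path.Homotopic.Quotient.trans_assoc]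

instance : ContinuousConstSMul (PiOne y₀) (UnivCover y₀) where
  continuous_const_smul a := by
    refine continuous_generateFrom_iff.2 ?_
    rintro _ ⟨x, U, hU, hx, rfl⟩
    refine TopologicalSpace.isOpen_generateFrom_of_mem ⟨a⁻¹ • x, U, hU, hx, ?_⟩
    ext z
    refine ⟨fun h => ?_, fun h => ?_⟩
    · simpa using smul_mem_whisker a⁻¹ h
    · simpa using smul_mem_whisker a h

end UnivCover

variable {W : Type v} [Group W] [MulAction W Y] [ContinuousConstSMul W Y]

/-- The action of `W` on the fundamental group at a fixed base point, as endomorphisms. -/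
def loopMap (y₀ : MulAction.fixedPoints W Y) (w : W) : PiOne (y₀ : Y) →* PiOne (y₀ : Y) :=
  MonoidHom.op (FundamentalGroup.mapOfEq (smulMap Y w) (y₀.2 w))

lemma loop_loopMap (y₀ : MulAction.fixedPoints W Y) (w : W) (a : PiOne (y₀ : Y)) :
    (loopMap y₀ w a).loop =
      (a.loop.map (smulMap Y w)).cast (y₀.2 w).symm (y₀.2 w).symm :=
  FundamentalGroup.mapOfEq_apply _ _ _

lemma PiOne.loop_injective {y₀ : Y} : Function.Injective (PiOne.loop (y₀ := y₀)) :=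
  MulOpposite.unop_injective

lemma PiOne.eq_of_path {y₀ : Y} {a b : PiOne y₀} (p q : Path y₀ y₀)
    (ha : a.loop = Path.Homotopic.Quotient.mk p) (hb : b.loop = Path.Homotopic.Quotient.mk q)
    (h : ∀ t, p t = q t) : a = b := by
  have : p = q := Path.ext (funext h)
  exact PiOne.loop_injective (by rw [ha, hb, this])

lemma loopMap_of_path (y₀ : MulAction.fixedPoints W Y) (w : W) (a : PiOne (y₀ : Y))
    (p : Path (y₀ : Y) y₀) (ha : a.loop = Path.Homotopic.Quotient.mk p) :
    (loopMap y₀ w a).loop = Path.Homotopic.Quotient.mk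
      ((p.map (smulMap Y w).continuous).cast (y₀.2 w).symm (y₀.2 w).symm) := by
  rw [loop_loopMap, ha]
  rfl

lemma loopMap_mul (y₀ : MulAction.fixedPoints W Y) (w w' : W) (a : PiOne (y₀ : Y)) :
    loopMap y₀ (w * w') a = loopMap y₀ w (loopMap y₀ w' a) := by
  obtain ⟨p, hp⟩ := Path.Homotopic.Quotient.mk_surjective a.loop
  exact PiOne.eq_of_path _ _ (loopMap_of_path y₀ _ a p hp.symm)
    (loopMap_of_path y₀ w _ _ (loopMap_of_path y₀ w' a p hp.symm)) fun t => mul_smul w w' (p t)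

lemma loopMap_one (y₀ : MulAction.fixedPoints W Y) (a : PiOne (y₀ : Y)) :
    loopMap y₀ (1 : W) a = a := by
  obtain ⟨p, hp⟩ := Path.Homotopic.Quotient.mk_surjective a.loop
  exact PiOne.eq_of_path _ _ (loopMap_of_path y₀ _ a p hp.symm) hp.symm fun t => one_smul W (p t)

/-- The action of `W` on `π₁(Y, y₀)` by automorphisms, `w [α] = [w α]`. -/
def piOneAct (y₀ : MulAction.fixedPoints W Y) : W →* MulAut (PiOne (y₀ : Y)) where
  toFun w :=
    { loopMap y₀ w with
      invFun := loopMap y₀ w⁻¹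
      left_inv := fun a => by
        change loopMap y₀ w⁻¹ (loopMap y₀ w a) = a
        rw [← loopMap_mul, inv_mul_cancel, loopMap_one]
      right_inv := fun a => by
        change loopMap y₀ w (loopMap y₀ w⁻¹ a) = a
        rw [← loopMap_mul, mul_inv_cancel, loopMap_one] }
  map_one' := MulEquiv.ext fun a => loopMap_one y₀ a
  map_mul' w w' := MulEquiv.ext fun a => loopMap_mul y₀ w w' a

namespace UnivCover

/-- The lift of the action of `w ∈ W` to the universal cover which fixes the base point:
`w [γ] = [w γ]`. -/
def smulW (y₀ : MulAction.fixedPoints W Y) (w : W) (x : UnivCover (y₀ : Y)) :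
    UnivCover (y₀ : Y) :=
  ⟨w • x.pt, (x.cls.map (smulMap Y w)).cast (y₀.2 w).symm rfl⟩

lemma smulW_mk (y₀ : MulAction.fixedPoints W Y) (w : W) {y : Y} (p : Path (y₀ : Y) y) :
    smulW y₀ w ⟨y, Path.Homotopic.Quotient.mk p⟩ =
      ⟨w • y, Path.Homotopic.Quotient.mk
        ((p.map (smulMap Y w).continuous).cast (y₀.2 w).symm rfl)⟩ := rfl

lemma smulW_one (y₀ : MulAction.fixedPoints W Y) (x : UnivCover (y₀ : Y)) :
    smulW y₀ (1 : W) x = x := by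
  obtain ⟨y, γ⟩ := x
  obtain ⟨p, rfl⟩ := Path.Homotopic.Quotient.mk_surjective γ
  exact mk_eq _ _ fun t => one_smul W (p t)

lemma smulW_mul (y₀ : MulAction.fixedPoints W Y) (w w' : W) (x : UnivCover (y₀ : Y)) :
    smulW y₀ (w * w') x = smulW y₀ w (smulW y₀ w' x) := by
  obtain ⟨y, γ⟩ := x
  obtain ⟨p, rfl⟩ := Path.Homotopic.Quotient.mk_surjective γ
  exact mk_eq _ _ fun t => mul_smul w w' (p t)

lemma smulW_smul (y₀ : MulAction.fixedPoints W Y) (w : W) (a : PiOne (y₀ : Y))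
    (x : UnivCover (y₀ : Y)) : smulW y₀ w (a • x) = piOneAct y₀ w a • smulW y₀ w x := by
  obtain ⟨y, γ⟩ := x
  obtain ⟨p, rfl⟩ := Path.Homotopic.Quotient.mk_surjective γ
  obtain ⟨q, hq⟩ := Path.Homotopic.Quotient.mk_surjective a.loop
  rw [smul_def, smul_def, ← hq, smulW_mk]
  change smulW y₀ w ⟨y, Path.Homotopic.Quotient.mk (q.trans p)⟩ =
    ⟨w • y, ((loopMap y₀ w a).loop).trans _⟩
  rw [loopMap_of_path y₀ w a q hq.symm, smulW_mk]
  refine mk_eq _ _ fun t => ?_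
  change w • (q.trans p) t = _
  rw [Path.trans_apply, Path.trans_apply]
  split_ifs <;> rfl

/-- The action of `π₁(Y) ⋊ W` on the universal cover, `(a, w) x = a (w x)`. -/
instance (y₀ : MulAction.fixedPoints W Y) :
    MulAction (PiOne (y₀ : Y) ⋊[piOneAct y₀] W) (UnivCover (y₀ : Y)) where
  smul g x := g.left • smulW y₀ g.right x
  one_smul x := by
    change (1 : PiOne (y₀ : Y)) • smulW y₀ (1 : W) x = x
    rw [one_smul, smulW_one]
  mul_smul g h x := by
    change (g.left * piOneAct y₀ g.right h.left) • smulW y₀ (g.right * h.right) x =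
      g.left • smulW y₀ g.right (h.left • smulW y₀ h.right x)
    rw [smulW_smul, smulW_mul, mul_smul]

lemma semidirect_smul_def (y₀ : MulAction.fixedPoints W Y)
    (g : PiOne (y₀ : Y) ⋊[piOneAct y₀] W) (x : UnivCover (y₀ : Y)) :
    g • x = g.left • smulW y₀ g.right x := rfl

lemma inl_smul (y₀ : MulAction.fixedPoints W Y) (a : PiOne (y₀ : Y)) (x : UnivCover (y₀ : Y)) :
    (SemidirectProduct.inl a : PiOne (y₀ : Y) ⋊[piOneAct y₀] W) • x = a • x := by
  rw [semidirect_smul_def, SemidirectProduct.left_inl, SemidirectProduct.right_inl, smulW_one]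

lemma smulW_mem_whisker (y₀ : MulAction.fixedPoints W Y) (w : W) {x z : UnivCover (y₀ : Y)}
    {U : Set Y} (h : z ∈ whisker x U) :
    smulW y₀ w z ∈ whisker (smulW y₀ w x) {y | w⁻¹ • y ∈ U} := by
  obtain ⟨y, γ⟩ := x
  obtain ⟨p, rfl⟩ := Path.Homotopic.Quotient.mk_surjective γ
  obtain ⟨y', γ'⟩ := z
  obtain ⟨η, hη, hz⟩ := h
  change Path y y' at η
  obtain rfl : γ' = Path.Homotopic.Quotient.mk (p.trans η) := hz
  refine ⟨η.map (smulMap Y w).continuous, fun t => ?_, ?_⟩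
  · change w⁻¹ • w • η t ∈ U
    rw [inv_smul_smul]
    exact hη t
  · change Path.Homotopic.Quotient.mk (((p.trans η).map (smulMap Y w).continuous).cast _ _) =
      Path.Homotopic.Quotient.mk (Path.trans
        ((p.map (smulMap Y w).continuous).cast (y₀.2 w).symm rfl)
        (η.map (smulMap Y w).continuous))
    refine congrArg _ (Path.ext (funext fun t => ?_))
    change w • (p.trans η) t = _
    rw [Path.trans_apply, Path.trans_apply]
    split_ifs <;> rfl

lemma continuous_smulW (y₀ : MulAction.fixedPoints W Y) (w : W) : Continuous (smulW y₀ w) := by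
  refine continuous_generateFrom_iff.2 ?_
  rintro _ ⟨x, U, hU, hx, rfl⟩
  refine TopologicalSpace.isOpen_generateFrom_of_mem
    ⟨smulW y₀ w⁻¹ x, {y | w • y ∈ U}, hU.preimage (continuous_const_smul w), ?_, ?_⟩
  · simpa [smulW] using hx
  · ext z
    refine ⟨fun h => ?_, fun h => ?_⟩
    · have := smulW_mem_whisker y₀ w⁻¹ h
      rwa [← smulW_mul, inv_mul_cancel, smulW_one, inv_inv] at this
    · have := smulW_mem_whisker y₀ w h
      rw [← smulW_mul, mul_inv_cancel, smulW_one] at this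
      simpa using this

instance (y₀ : MulAction.fixedPoints W Y) :
    ContinuousConstSMul (PiOne (y₀ : Y) ⋊[piOneAct y₀] W) (UnivCover (y₀ : Y)) where
  continuous_const_smul g := (continuous_const_smul g.left).comp (continuous_smulW y₀ g.right)

end UnivCover

end Cover

/-! ### Equivariant CW complexes -/

section CW

open Topology

/-- A `W`-CW complex for a discrete group `W`: a CW structure on `Y` together with an action of `W`
on the set of `n`-cells for each `n`, such that the characteristic maps are equivariant, i.e. the
characteristic map of the cell `w e` is that of `e` followed by `w`. Grouping the cells into orbits
`W / H`, these are the equivariant cells `W / H × Dⁿ`. -/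
class EquivariantCW (W : Type v) [Group W] (Y : Type u) [TopologicalSpace Y] [MulAction W Y]
    [CWComplex (Set.univ : Set Y)]
    [∀ n, MulAction W (RelCWComplex.cell (Set.univ : Set Y) n)] : Prop where
  map_smul : ∀ (n : ℕ) (w : W) (e : RelCWComplex.cell (Set.univ : Set Y) n),
    ∀ x ∈ Metric.closedBall (0 : Fin n → ℝ) 1,
      RelCWComplex.map (C := (Set.univ : Set Y)) n (w • e) x =
        w • RelCWComplex.map (C := (Set.univ : Set Y)) n e x

/-- Finite type: finitely many equivariant cells in each dimension. -/
class EquivariantFiniteType (W : Type v) [Group W] (Y : Type u) [TopologicalSpace Y]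
    [CWComplex (Set.univ : Set Y)]
    [∀ n, MulAction W (RelCWComplex.cell (Set.univ : Set Y) n)] : Prop where
  finite_orbits : ∀ n,
    Finite (MulAction.orbitRel.Quotient W (RelCWComplex.cell (Set.univ : Set Y) n))

variable {W : Type v} [Group W] {Y : Type u} [TopologicalSpace Y] [T2Space Y] [MulAction W Y]
  [CWComplex (Set.univ : Set Y)] [∀ n, MulAction W (RelCWComplex.cell (Set.univ : Set Y) n)]
  [EquivariantCW W Y]

variable (W Y) in
/-- The skeletal filtration of a `W`-CW complex; `sk n` is the `(n-1)`-skeleton. -/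
def skeletalFiltration : InvFiltration W Y where
  sk n := (RelCWComplex.skeletonLT (Set.univ : Set Y) (n : ℕ∞) : Set Y)
  smul_mem n w y hy := by
    rw [CWComplex.coe_skeletonLT] at hy ⊢
    simp only [Set.empty_union, Set.mem_iUnion] at hy ⊢
    obtain ⟨m, hm, e, x, hx, rfl⟩ := hy
    exact ⟨m, hm, w • e, x, hx, EquivariantCW.map_smul m w e x hx⟩

variable [ContinuousConstSMul W Y]

variable (Y) in
/-- The skeletal filtration of the universal cover, with the lifted CW structure: its skeleta are
the preimages of those of `Y`. -/
def coverFiltration (y₀ : MulAction.fixedPoints W Y) :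
    InvFiltration (PiOne (y₀ : Y) ⋊[piOneAct y₀] W) (UnivCover (y₀ : Y)) where
  sk n := {x | x.pt ∈ (skeletalFiltration W Y).sk n}
  smul_mem n g x hx := (skeletalFiltration W Y).smul_mem n g.right x.pt hx

end CW

end BredonRational

end

open scoped Manifold ContDiff

noncomputable section

namespace BredonRational

universe u v w

set_option linter.unusedSectionVars false

/-! ### Cochains with coefficients in fixed points are equivariant homomorphisms -/

section EquivariantHom

variable {Γ : Type v} [Group Γ] {X : Type u} [TopologicalSpace X] [MulAction Γ X]
  [ContinuousConstSMul Γ X] {A : Type w} [CommRing A] {V : Type w} [AddCommGroup V] [Module A V]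

/-! For coefficients `Γ ⧸ H ↦ V ^ H`, a Bredon cochain is the same thing as a `Γ`-equivariant
homomorphism from the cellular chains of the whole space to `V`. Its value at the orbit `Γ ⧸ 1` is
such a homomorphism. The projection `Γ ⧸ 1 → Γ ⧸ H` determines every other value from it
(`cochainVal_eq_cochainHom`). Conversely, an equivariant homomorphism takes chains of `X ^ H` into
`V ^ H` automatically (`cochainOfHom`).

For `Γ = N ⋊ W` this identifies the cochain complex of `Γ` with the `W`-invariants of the cochain
complex of `N`: restriction to `N` is an injective cochain map (`restrictCochain_injective`) whose
image is the invariant cochains (`restrictCochain_mem_invariants`, `exists_restrictCochain_eq`).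
When `W` is finite and its order is invertible in the ground ring, averaging makes invariants exact.
An invariant coboundary is then the coboundary of an invariant cochain, and an invariant class has
an invariant representative. So cohomology commutes with invariants (`bredonHEquivInvariants`).
Nothing here depends on the cell structure beyond the invariance of the filtration.

The ground ring `R(G)_ℚ` is a `ℚ`-algebra, so it remains to see that the Weyl group is finite, that
is, that `T` is open in its compact normalizer. An element `g` of the normalizer close to `1` gives
a homomorphism `t ↦ g t g⁻¹ t⁻¹` on `T` with image close to `1`. A Lie group has no small subgroups,
so `g` centralizes `T` (`IsTorus.eventually_commute`). An element close to `1` that centralizes `T`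
has successive square roots tending to `1`. Uniqueness of small roots makes them commute with `T`
and with each other, so together with `T` they topologically generate a torus, which is `T` by
maximality (`IsMaximalTorus.eventually_mem_of_commute`). Both facts rest on squaring having
derivative `2` at the identity; no exponential map is needed. -/

lemma InvFiltration.mapsTo_fixed_bot (F : InvFiltration Γ X) (m : ℕ) :
    Set.MapsTo (ContinuousMap.id X) (F.sk m) (F.fixed (⊥ : Subgroup Γ) m) := by
  refine fun x hx => ⟨hx, fun h hh => ?_⟩
  rw [Subgroup.mem_bot.1 hh]
  exact one_smul Γ x

lemma InvFiltration.mapsTo_sk (F : InvFiltration Γ X) (H : Subgroup Γ) (m : ℕ) :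
    Set.MapsTo (ContinuousMap.id X) (F.fixed H m) (F.sk m) :=
  fun _ hx => hx.1

lemma InvFiltration.mapsTo_smul (F : InvFiltration Γ X) (g : Γ) (m : ℕ) :
    Set.MapsTo (smulMap X g) (F.sk m) (F.sk m) :=
  fun x hx => F.smul_mem m g x hx

variable {F : InvFiltration Γ X} {ρ : Representation A Γ V} {n : ℕ}

/-- The homomorphism on the cellular chains of the whole space underlying a Bredon cochain with
coefficients `Γ ⧸ H ↦ V ^ H`: its value at the orbit `Γ ⧸ 1`. -/
def cochainHom (η : BredonCochain F (fixedCoeff ρ) n) : CellChain F.sk n →+ V :=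
  (cochainVal η ⟨⊥⟩).comp (cellMap (ContinuousMap.id X) F.mapsTo_fixed_bot n)

/-- Naturality along the projection `Γ ⧸ 1 → Γ ⧸ H`, which is represented by `1`: on chains it is
induced by the inclusion of `X ^ H` in `X`, on coefficients it is the inclusion of `V ^ H` in `V`.
-/
lemma cochainVal_eq_cochainHom (η : BredonCochain F (fixedCoeff ρ) n) (H : OrbitCat Γ)
    (c : BredonChain F n H) :
    cochainVal η H c =
      cochainHom η (cellMap (ContinuousMap.id X) (F.mapsTo_sk H.stab) n c) := by
  have h1 : ∀ h ∈ (⟨⊥⟩ : OrbitCat Γ).stab, (1 : Γ)⁻¹ * h * 1 ∈ H.stab := by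
    intro h hh
    rw [Subgroup.mem_bot.1 hh]
    simp
  have h2 := cochainVal_smul η (OrbitCat.ofRep _ h1) (OrbitCat.represents_ofRep _ h1) c
  rw [map_one, Module.End.one_apply] at h2
  rw [← h2, cochainHom, AddMonoidHom.comp_apply, cellMap_comp]
  exact congrArg _ (cellMap_congr _ _ _ _ (fun m x _ => one_smul Γ x) n c)

/-- Every `g` represents an endomorphism of the orbit `Γ ⧸ 1`, and naturality along it is
equivariance under `g`. -/
lemma cochainHom_smul (η : BredonCochain F (fixedCoeff ρ) n) (g : Γ) (c : CellChain F.sk n) :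
    cochainHom η (cellMap (smulMap X g) (F.mapsTo_smul g) n c) = ρ g (cochainHom η c) := by
  have h1 : ∀ h ∈ (⟨⊥⟩ : OrbitCat Γ).stab, g⁻¹ * h * g ∈ (⟨⊥⟩ : OrbitCat Γ).stab := by
    intro h hh
    rw [Subgroup.mem_bot.1 hh]
    simp
  rw [cochainHom, AddMonoidHom.comp_apply, AddMonoidHom.comp_apply,
    ← cochainVal_smul η (OrbitCat.ofRep _ h1) (OrbitCat.represents_ofRep _ h1),
    cellMap_comp, cellMap_comp]
  rfl

lemma cochainHom_injective {η η' : BredonCochain F (fixedCoeff ρ) n}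
    (h : ∀ c, cochainHom η c = cochainHom η' c) : η = η' :=
  cochain_ext fun H c => by
    rw [cochainVal_eq_cochainHom, cochainVal_eq_cochainHom, h]

lemma cochainHom_bredonD (η : BredonCochain F (fixedCoeff ρ) n) (c : CellChain F.sk (n + 1)) :
    cochainHom (bredonD F (fixedCoeff ρ) n η) c = cochainHom η (cellD F.sk n c) := by
  rw [cochainHom, cochainHom, AddMonoidHom.comp_apply, AddMonoidHom.comp_apply, cellMap_cellD]
  rfl

/-- The Bredon cochain defined by an equivariant homomorphism on cellular chains. -/
def cochainOfHom (ψ : CellChain F.sk n →+ V)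
    (hψ : ∀ g c, ψ (cellMap (smulMap X g) (F.mapsTo_smul g) n c) = ρ g (ψ c)) :
    BredonCochain F (fixedCoeff ρ) n :=
  ⟨fun H => AddMonoidHom.codRestrict
      (ψ.comp (cellMap (ContinuousMap.id X) (F.mapsTo_sk H.stab) n))
      (Representation.invariants (ρ.comp H.stab.subtype)) (by
        rintro c ⟨h, hh⟩
        -- An element `h` of `H` acts on `X ^ H` as the identity, so equivariance forces the value
        -- of `ψ` to be fixed by `h`.
        change ρ h (ψ _) = ψ _
        rw [← hψ, cellMap_comp]
        exact congrArg ψ (cellMap_congr _ _ _ _ (fun m x hx => hx.2 h hh) n c)), by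
    intro H K f c
    refine Subtype.ext ?_
    refine Eq.trans ?_ (fixedCoeff_map ρ f (OrbitCat.represents_rep f) _).symm
    change ψ (cellMap _ _ n (cellMap (smulMap X (OrbitCat.rep f)) _ n c)) =
      ρ (OrbitCat.rep f) (ψ (cellMap _ _ n c))
    rw [← hψ, cellMap_comp, cellMap_comp]
    rfl⟩

lemma cochainHom_cochainOfHom (ψ : CellChain F.sk n →+ V)
    (hψ : ∀ g c, ψ (cellMap (smulMap X g) (F.mapsTo_smul g) n c) = ρ g (ψ c))
    (c : CellChain F.sk n) : cochainHom (cochainOfHom ψ hψ) c = ψ c := by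
  change ψ (cellMap _ _ n (cellMap _ _ n c)) = ψ c
  rw [cellMap_comp]
  exact congrArg ψ (cellMap_id _ n c)

end EquivariantHom

/-! ### Restriction to the normal factor of a semidirect product -/

section Restriction

variable {N : Type v} {W : Type w} [Group N] [Group W] {θ : W →* MulAut N} {X : Type u}
  [TopologicalSpace X] [MulAction (N ⋊[θ] W) X] [ContinuousConstSMul (N ⋊[θ] W) X]
  [MulAction N X] [ContinuousConstSMul N X]
  {A : Type w} [CommRing A] {V : Type w} [AddCommGroup V] [Module A V]
  (F : InvFiltration (N ⋊[θ] W) X)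
  (hX : ∀ (a : N) (x : X), (SemidirectProduct.inl a : N ⋊[θ] W) • x = a • x)
  (ρ : Representation A (N ⋊[θ] W) V) (n : ℕ)

/-- The action of `W` on the Bredon cochains `C^n_N(X; V^{(-)})`. -/
def cochainRep :
    Representation A W (BredonCochain (F.res hX) (fixedCoeff (ρ.comp SemidirectProduct.inl)) n) where
  toFun w := (semidirectTwist F hX ρ w).onCochain n
  map_one' := by
    refine LinearMap.ext fun η => Twist.onCochain_of_one _ ?_ ?_ ?_ n η
    · ext a; simp [semidirectTwist]
    · ext x; simp [semidirectTwist, smulMap]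
    · simp [semidirectTwist, Module.End.one_eq_id]
  map_mul' w₁ w₂ := by
    refine LinearMap.ext fun η => Twist.onCochain_of_mul _ _ _ ?_ ?_ ?_ n η
    · ext a; simp [semidirectTwist]
    · ext x; simp [semidirectTwist, smulMap, smul_smul]
    · simp [semidirectTwist, Module.End.mul_eq_comp]

/-- The homomorphism on cellular chains underlying a cochain of the normal factor `N`. -/
def normalHom (η : BredonCochain (F.res hX) (fixedCoeff (ρ.comp SemidirectProduct.inl)) n) :
    CellChain F.sk n →+ V :=
  cochainHom (F := F.res hX) (ρ := ρ.comp SemidirectProduct.inl) η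

lemma normalHom_injective
    {η η' : BredonCochain (F.res hX) (fixedCoeff (ρ.comp SemidirectProduct.inl)) n}
    (h : ∀ c, normalHom F hX ρ n η c = normalHom F hX ρ n η' c) : η = η' :=
  cochainHom_injective (F := F.res hX) (ρ := ρ.comp SemidirectProduct.inl) h

lemma normalHom_add
    (η η' : BredonCochain (F.res hX) (fixedCoeff (ρ.comp SemidirectProduct.inl)) n)
    (c : CellChain F.sk n) :
    normalHom F hX ρ n (η + η') c = normalHom F hX ρ n η c + normalHom F hX ρ n η' c := rfl

lemma normalHom_coeff_smul (r : A)
    (η : BredonCochain (F.res hX) (fixedCoeff (ρ.comp SemidirectProduct.inl)) n)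
    (c : CellChain F.sk n) :
    normalHom F hX ρ n (r • η) c = r • normalHom F hX ρ n η c := rfl

/-- The action of `N` on `X` agrees with the one through `inl` by `hX`. In this form the
equivariance can be compared with that of a cochain for `N ⋊ W`. -/
lemma normalHom_inl_smul
    (η : BredonCochain (F.res hX) (fixedCoeff (ρ.comp SemidirectProduct.inl)) n)
    (a : N) (c : CellChain F.sk n) :
    normalHom F hX ρ n η (cellMap (smulMap X (SemidirectProduct.inl a : N ⋊[θ] W))
      (F.mapsTo_smul _) n c) = ρ (SemidirectProduct.inl a) (normalHom F hX ρ n η c) := by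
  refine Eq.trans ?_ (cochainHom_smul (F := F.res hX) (ρ := ρ.comp SemidirectProduct.inl) η a c)
  exact congrArg (normalHom F hX ρ n η) (cellMap_congr (A := F.sk) (A' := F.sk) _ (smulMap X a)
    (F.mapsTo_smul _) ((F.res hX).mapsTo_smul a) (fun m x _ => hX a x) n c)

lemma normalHom_bredonD
    (η : BredonCochain (F.res hX) (fixedCoeff (ρ.comp SemidirectProduct.inl)) n)
    (c : CellChain F.sk (n + 1)) :
    normalHom F hX ρ (n + 1) (bredonD (F.res hX) _ n η) c =
      normalHom F hX ρ n η (cellD F.sk n c) :=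
  cochainHom_bredonD (F := F.res hX) (ρ := ρ.comp SemidirectProduct.inl) η c

lemma normalHom_cochainRep (w : W)
    (η : BredonCochain (F.res hX) (fixedCoeff (ρ.comp SemidirectProduct.inl)) n)
    (c : CellChain F.sk n) :
    normalHom F hX ρ n (cochainRep F hX ρ n w η) c = ρ (SemidirectProduct.inr w)
      (normalHom F hX ρ n η (cellMap (smulMap X (SemidirectProduct.inr w⁻¹ : N ⋊[θ] W))
        (F.mapsTo_smul _) n c)) := by
  let τ := semidirectTwist F hX ρ w
  let c' : BredonChain (F.res hX) n ⟨⊥⟩ :=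
    cellMap (A := F.sk) (ContinuousMap.id X) (F.res hX).mapsTo_fixed_bot n c
  refine (τ.cochainVal_onCochain n η ⟨⊥⟩ c').trans ?_
  refine congrArg (ρ (SemidirectProduct.inr w)) ?_
  -- The twisted cochain is evaluated at the orbit of the image of `⊥` under the twisting
  -- homomorphism. Passing to chains of the whole space avoids identifying that subgroup with `⊥`.
  refine (cochainVal_eq_cochainHom η _ _).trans (congrArg (normalHom F hX ρ n η) ?_)
  exact (cellMap_comp _ _ _ _ n c').trans (cellMap_comp (A := F.sk) _ _ _ _ n c)

/-- The cochain of the normal factor `N` defined by an `N`-equivariant homomorphism. -/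
def normalCochain (ψ : CellChain F.sk n →+ V)
    (hψ : ∀ (a : N) c, ψ (cellMap (smulMap X (SemidirectProduct.inl a : N ⋊[θ] W))
      (F.mapsTo_smul _) n c) = ρ (SemidirectProduct.inl a) (ψ c)) :
    BredonCochain (F.res hX) (fixedCoeff (ρ.comp SemidirectProduct.inl)) n :=
  cochainOfHom (F := F.res hX) (ρ := ρ.comp SemidirectProduct.inl) ψ fun a c => by
    refine Eq.trans (congrArg ψ ?_) (hψ a c)
    exact cellMap_congr (A := F.sk) (A' := F.sk) (smulMap X a) _
      ((F.res hX).mapsTo_smul a) (F.mapsTo_smul _) (fun m x _ => (hX a x).symm) n c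

lemma normalHom_normalCochain (ψ : CellChain F.sk n →+ V)
    (hψ : ∀ (a : N) c, ψ (cellMap (smulMap X (SemidirectProduct.inl a : N ⋊[θ] W))
      (F.mapsTo_smul _) n c) = ρ (SemidirectProduct.inl a) (ψ c)) (c : CellChain F.sk n) :
    normalHom F hX ρ n (normalCochain F hX ρ n ψ hψ) c = ψ c :=
  cochainHom_cochainOfHom (F := F.res hX) (ρ := ρ.comp SemidirectProduct.inl) ψ _ c

/-- Restriction of Bredon cochains along the inclusion `N → N ⋊ W`. -/
def restrictCochain : BredonCochain F (fixedCoeff ρ) n →ₗ[A]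
    BredonCochain (F.res hX) (fixedCoeff (ρ.comp SemidirectProduct.inl)) n where
  toFun η := normalCochain F hX ρ n (cochainHom η) fun a c => cochainHom_smul η _ c
  map_add' η η' := normalHom_injective F hX ρ n fun c => by
    rw [normalHom_normalCochain, normalHom_add, normalHom_normalCochain, normalHom_normalCochain]
    rfl
  map_smul' a η := normalHom_injective F hX ρ n fun c => by
    rw [normalHom_normalCochain, RingHom.id_apply, normalHom_coeff_smul, normalHom_normalCochain]
    rfl

/-- Restriction keeps the underlying homomorphism and only forgets its equivariance under `W`. -/
lemma normalHom_restrictCochain (η : BredonCochain F (fixedCoeff ρ) n) (c : CellChain F.sk n) :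
    normalHom F hX ρ n (restrictCochain F hX ρ n η) c = cochainHom η c :=
  normalHom_normalCochain F hX ρ n (cochainHom η) (fun _ c => cochainHom_smul η _ c) c

lemma restrictCochain_injective : Function.Injective (restrictCochain F hX ρ n) :=
  fun η η' h => cochainHom_injective fun c => by
    rw [← normalHom_restrictCochain F hX, h, normalHom_restrictCochain]

lemma restrictCochain_bredonD (η : BredonCochain F (fixedCoeff ρ) n) :
    restrictCochain F hX ρ (n + 1) (bredonD F _ n η) =
      bredonD (F.res hX) _ n (restrictCochain F hX ρ n η) :=
  normalHom_injective F hX ρ (n + 1) fun c => by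
    rw [normalHom_restrictCochain, normalHom_bredonD, cochainHom_bredonD,
      normalHom_restrictCochain]

/-- For an equivariant `ψ` one has `w ψ(w⁻¹ c) = ψ(c)`. -/
lemma restrictCochain_mem_invariants (η : BredonCochain F (fixedCoeff ρ) n) :
    restrictCochain F hX ρ n η ∈ (cochainRep F hX ρ n).invariants := fun w =>
  normalHom_injective F hX ρ n fun c => by
    rw [normalHom_cochainRep, normalHom_restrictCochain, normalHom_restrictCochain,
      cochainHom_smul, ← Module.End.mul_apply, ← map_mul, ← map_mul, mul_inv_cancel, map_one,
      map_one, Module.End.one_apply]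

/-- Invariance under `W` is equivariance under the complement `W`. Together with `N`-equivariance it
gives equivariance under `N ⋊ W`, so the underlying homomorphism of `ξ` already defines the required
cochain. -/
lemma exists_restrictCochain_eq
    {ξ : BredonCochain (F.res hX) (fixedCoeff (ρ.comp SemidirectProduct.inl)) n}
    (hξ : ξ ∈ (cochainRep F hX ρ n).invariants) :
    ∃ η, restrictCochain F hX ρ n η = ξ := by
  have hr : ∀ (w : W) (c : CellChain F.sk n), normalHom F hX ρ n ξ (cellMap
      (smulMap X (SemidirectProduct.inr w : N ⋊[θ] W)) (F.mapsTo_smul _) n c) =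
        ρ (SemidirectProduct.inr w) (normalHom F hX ρ n ξ c) := fun w c => by
    -- Invariance under `w⁻¹` reads `ψ(c) = w⁻¹ ψ(w c)`; applying `w` gives the claim.
    have h := normalHom_cochainRep F hX ρ n w⁻¹ ξ c
    rw [hξ w⁻¹] at h
    rw [h, ← Module.End.mul_apply, ← map_mul, ← map_mul, mul_inv_cancel, map_one, map_one,
      Module.End.one_apply]
    exact congrArg _ (cellMap_congr _ _ _ _ (fun m x _ => by rw [inv_inv]) n c)
  have hg : ∀ (g : N ⋊[θ] W) (c : CellChain F.sk n), normalHom F hX ρ n ξ (cellMap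
      (smulMap X g) (F.mapsTo_smul _) n c) = ρ g (normalHom F hX ρ n ξ c) := fun g c => by
    -- Every element of `N ⋊ W` is a product of an element of `N` and one of `W`, so the two
    -- equivariances combine.
    conv_rhs => rw [← SemidirectProduct.inl_left_mul_inr_right g, map_mul, Module.End.mul_apply,
      ← hr, ← normalHom_inl_smul, cellMap_comp]
    refine congrArg _ (cellMap_congr _ _ _ _ (fun m x _ => ?_) n c)
    change g • x = (SemidirectProduct.inl g.left : N ⋊[θ] W) •
      (SemidirectProduct.inr g.right : N ⋊[θ] W) • x
    rw [smul_smul, SemidirectProduct.inl_left_mul_inr_right]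
  refine ⟨cochainOfHom (normalHom F hX ρ n ξ) hg, normalHom_injective F hX ρ n fun c => ?_⟩
  rw [normalHom_restrictCochain, cochainHom_cochainOfHom]

/-! ### Averaging over a finite group -/

lemma averageMap_apply {k G U : Type*} [CommRing k] [Group G] [Fintype G]
    [Invertible (Fintype.card G : k)] [AddCommGroup U] [Module k U] (σ : Representation k G U)
    (x : U) : σ.averageMap x = ⅟(Fintype.card G : k) • ∑ g, σ g x := by
  simp [Representation.averageMap, GroupAlgebra.average, map_sum]

/-- Used twice: with `f` the coboundary, and with `f` the projection from cocycles to cohomology. -/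
lemma averageMap_comm {k G U U' : Type*} [CommRing k] [Group G] [Fintype G]
    [Invertible (Fintype.card G : k)] [AddCommGroup U] [Module k U] [AddCommGroup U'] [Module k U']
    (σ : Representation k G U) (σ' : Representation k G U') (f : U →ₗ[k] U')
    (hf : ∀ g x, f (σ g x) = σ' g (f x)) (x : U) :
    f (σ.averageMap x) = σ'.averageMap (f x) := by
  rw [averageMap_apply, averageMap_apply, map_smul, map_sum]
  simp only [hf]

/-! ### Restriction on cocycles, coboundaries and cohomology. -/

lemma cochainRep_bredonD (w : W)
    (η : BredonCochain (F.res hX) (fixedCoeff (ρ.comp SemidirectProduct.inl)) n) :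
    bredonD (F.res hX) _ n (cochainRep F hX ρ n w η) =
      cochainRep F hX ρ (n + 1) w (bredonD (F.res hX) _ n η) :=
  ((semidirectTwist F hX ρ w).onCochain_bredonD n η).symm

/-- Restriction is an injective cochain map, so it reflects the vanishing of the coboundary; no
averaging is needed. -/
lemma restrictCochain_mem_bredonZ {η : BredonCochain F (fixedCoeff ρ) n} :
    restrictCochain F hX ρ n η ∈ bredonZ (F.res hX) _ n ↔ η ∈ bredonZ F _ n := by
  rw [bredonZ, bredonZ, LinearMap.mem_ker, LinearMap.mem_ker, ← restrictCochain_bredonD,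
    map_eq_zero_iff _ (restrictCochain_injective F hX ρ (n + 1))]

/-- This is injectivity on cohomology. If the restriction of `η` is `dξ`, it is also `d` of the
average of `ξ`, because it is invariant and averaging commutes with `d`. The averaged cochain is
invariant, hence a restriction. Degree `0` is separate because there the coboundaries are zero. -/
lemma restrictCochain_mem_bredonB [Fintype W] [Invertible (Fintype.card W : A)]
    {η : BredonCochain F (fixedCoeff ρ) n} :
    restrictCochain F hX ρ n η ∈ bredonB (F.res hX) _ n ↔ η ∈ bredonB F _ n := by
  cases n with
  | zero =>
    rw [bredonB, bredonB, Submodule.mem_bot, Submodule.mem_bot,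
      map_eq_zero_iff _ (restrictCochain_injective F hX ρ 0)]
  | succ n =>
    refine ⟨?_, ?_⟩
    · rintro ⟨ξ, hξ⟩
      obtain ⟨ζ, hζ⟩ := exists_restrictCochain_eq F hX ρ n
        ((cochainRep F hX ρ n).averageMap_invariant ξ)
      refine ⟨ζ, restrictCochain_injective F hX ρ (n + 1) ?_⟩
      rw [restrictCochain_bredonD, hζ,
        averageMap_comm _ (cochainRep F hX ρ (n + 1)) _ (cochainRep_bredonD F hX ρ n), hξ]
      exact Representation.averageMap_id _ _ (restrictCochain_mem_invariants F hX ρ (n + 1) η)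
    · rintro ⟨ξ, rfl⟩
      exact ⟨restrictCochain F hX ρ n ξ, (restrictCochain_bredonD F hX ρ n ξ).symm⟩

/-- Restriction of cocycles, with values in the invariant cohomology classes. -/
def restrictCocycle : bredonZ F (fixedCoeff ρ) n →ₗ[A] (quotientRep F hX ρ n).invariants :=
  ((Submodule.mkQ _).comp ((restrictCochain F hX ρ n).restrict
    fun _ h => (restrictCochain_mem_bredonZ F hX ρ n).2 h)).codRestrict _ fun η w =>
      congrArg (Submodule.Quotient.mk (p := (bredonB (F.res hX) _ n).submoduleOf _))
        (Subtype.ext (restrictCochain_mem_invariants F hX ρ n η.1 w))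

lemma ker_restrictCocycle [Fintype W] [Invertible (Fintype.card W : A)] :
    LinearMap.ker (restrictCocycle F hX ρ n) =
      (bredonB F (fixedCoeff ρ) n).submoduleOf (bredonZ F (fixedCoeff ρ) n) := by
  ext η
  rw [LinearMap.mem_ker, ← Submodule.coe_eq_zero]
  refine (Submodule.Quotient.mk_eq_zero _).trans ?_
  exact restrictCochain_mem_bredonB F hX ρ n

/-- Averaging a representative of an invariant class gives an invariant cocycle, hence a
restriction. Its class is the average of the given class, which is the class itself. -/
lemma restrictCocycle_surjective [Fintype W] [Invertible (Fintype.card W : A)] :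
    Function.Surjective (restrictCocycle F hX ρ n) := by
  rintro ⟨x, hx⟩
  -- The action is taken on cocycles rather than cochains, so the average is a cocycle by
  -- construction.
  let σ : Representation A W
      (bredonZ (F.res hX) (fixedCoeff (ρ.comp SemidirectProduct.inl)) n) :=
    { toFun := fun w => ((semidirectTwist F hX ρ w).onCochain n).restrict
        fun _ h => (semidirectTwist F hX ρ w).onCochain_mem_bredonZ n h
      map_one' := LinearMap.ext fun η => Subtype.ext
        (LinearMap.congr_fun (map_one (cochainRep F hX ρ n)) η.1)
      map_mul' := fun w w' => LinearMap.ext fun η => Subtype.ext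
        (LinearMap.congr_fun (map_mul (cochainRep F hX ρ n) w w') η.1) }
  obtain ⟨ξ, rfl⟩ := Submodule.Quotient.mk_surjective _ x
  obtain ⟨η, hη⟩ := exists_restrictCochain_eq F hX ρ n (ξ := (σ.averageMap ξ).1)
    fun w => congrArg Subtype.val (σ.averageMap_invariant ξ w)
  have hZ : η ∈ bredonZ F (fixedCoeff ρ) n := by
    rw [← restrictCochain_mem_bredonZ F hX, hη]
    exact (σ.averageMap ξ).2
  refine ⟨⟨η, hZ⟩, Subtype.ext ?_⟩
  have h1 : (Submodule.mkQ _) (σ.averageMap ξ) =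
      (quotientRep F hX ρ n).averageMap (Submodule.mkQ _ ξ) :=
    averageMap_comm σ (quotientRep F hX ρ n) _ (fun w ζ => rfl) ξ
  refine Eq.trans ?_ (h1.trans (Representation.averageMap_id _ _ hx))
  exact congrArg (Submodule.Quotient.mk (p := (bredonB (F.res hX) _ n).submoduleOf _))
    (Subtype.ext hη)

/-- If `W` is finite of order invertible in `A`, the Bredon cohomology of `N ⋊ W` with coefficients
in fixed points of `V` is the `W`-invariant part of that of `N`. -/
def bredonHEquivInvariants [Fintype W] [Invertible (Fintype.card W : A)] :
    BredonH F (fixedCoeff ρ) n ≃ₗ[A] (quotientRep F hX ρ n).invariants :=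
  (Submodule.quotEquivOfEq _ _ (ker_restrictCocycle F hX ρ n).symm).trans
    (LinearMap.quotKerEquivOfSurjective _ (restrictCocycle_surjective F hX ρ n))

end Restriction

/-! ### Squaring in a Lie group -/

open Topology Filter Set
open scoped Manifold ContDiff

section LieSquaring

variable {E : Type*} [NormedAddCommGroup E] [NormedSpace ℝ E]
  {G : Type*} [TopologicalSpace G] [ChartedSpace E G] [Group G] [LieGroup 𝓘(ℝ, E) ∞ G]

variable (E G) in
/-- The squaring map of a Lie group, in the chart around the identity. -/
def chartSq (x : E) : E :=
  extChartAt 𝓘(ℝ, E) (1 : G)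
    ((extChartAt 𝓘(ℝ, E) (1 : G)).symm x * (extChartAt 𝓘(ℝ, E) (1 : G)).symm x)

variable (E G) in
-- In the chart, multiplication `m` satisfies `m(x, e) = x = m(e, x)` near `e`, so both partial
-- derivatives at `(e, e)` are the identity and the derivative along the diagonal is their sum. The
-- derivative is stated as a continuous linear equivalence so that the inverse function theorem
-- applies.
lemma hasStrictFDerivAt_chartSq :
    HasStrictFDerivAt (chartSq E G)
      (ContinuousLinearEquiv.smulLeft (Units.mk0 (2 : ℝ) two_ne_zero) :
        E ≃L[ℝ] E).toContinuousLinearMap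
      (extChartAt 𝓘(ℝ, E) (1 : G) 1) := by
  have : IsManifold 𝓘(ℝ, E) ∞ G := inferInstance
  set φ := extChartAt 𝓘(ℝ, E) (1 : G)
  set e := φ 1
  have hsymm : φ.symm e = 1 := extChartAt_to_inv (I := 𝓘(ℝ, E)) (1 : G)
  let m : E × E → E := fun p => φ (φ.symm p.1 * φ.symm p.2)
  have hinv : ContMDiffAt 𝓘(ℝ, E) 𝓘(ℝ, E) ∞ φ.symm e :=
    (contMDiffOn_extChartAt_symm (1 : G)).contMDiffAt (extChartAt_target_mem_nhds (1 : G))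
  have hmul : ContMDiffAt 𝓘(ℝ, E × E) 𝓘(ℝ, E) ∞
      (fun p : E × E => φ.symm p.1 * φ.symm p.2) (e, e) :=
    ContMDiffAt.mul
      (ContMDiffAt.comp (e, e) hinv (contMDiffAt_iff_contDiffAt.2 contDiffAt_fst))
      (ContMDiffAt.comp (e, e) hinv (contMDiffAt_iff_contDiffAt.2 contDiffAt_snd))
  have hm : ContDiffAt ℝ ∞ m (e, e) := by
    refine contMDiffAt_iff_contDiffAt.1 (ContMDiffAt.comp (I' := 𝓘(ℝ, E)) (e, e) ?_ hmul)
    have : φ.symm (e, e).1 * φ.symm (e, e).2 = 1 := by simp [hsymm]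
    rw [this]
    exact contMDiffAt_extChartAt
  have hL := hm.hasStrictFDerivAt (by simp)
  set L := fderiv ℝ m (e, e)
  have hright : ∀ᶠ x in 𝓝 e, φ (φ.symm x) = x := by
    filter_upwards [extChartAt_target_mem_nhds (I := 𝓘(ℝ, E)) (1 : G)] with x hx
    exact φ.right_inv hx
  have h1 : L.comp (ContinuousLinearMap.inl ℝ E E) = ContinuousLinearMap.id ℝ E := by
    refine HasFDerivAt.unique (f := fun x : E => m (x, e)) (x := e) ?_ ?_
    · exact HasFDerivAt.comp (g := m) (f := fun x => (x, e)) e hL.hasFDerivAt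
        (hasFDerivAt_prodMk_left e e)
    · refine (hasFDerivAt_id e).congr_of_eventuallyEq ?_
      filter_upwards [hright] with x hx
      simp [m, hsymm, hx]
  have h2 : L.comp (ContinuousLinearMap.inr ℝ E E) = ContinuousLinearMap.id ℝ E := by
    refine HasFDerivAt.unique (f := fun x : E => m (e, x)) (x := e) ?_ ?_
    · exact HasFDerivAt.comp (g := m) (f := fun x => (e, x)) e hL.hasFDerivAt
        (hasFDerivAt_prodMk_right e e)
    · refine (hasFDerivAt_id e).congr_of_eventuallyEq ?_
      filter_upwards [hright] with x hx
      simp [m, hsymm, hx]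
  have hd := HasStrictFDerivAt.comp (f := fun x : E => (x, x)) (g := m) e hL
    ((hasStrictFDerivAt_id e).prodMk (hasStrictFDerivAt_id e))
  refine hd.congr_fderiv ?_
  ext v
  have h3 : L (v, v) = L (v, 0) + L (0, v) := by rw [← map_add]; simp
  have h4 : L (v, 0) = v := DFunLike.congr_fun h1 v
  have h5 : L (0, v) = v := DFunLike.congr_fun h2 v
  change L (v, v) = (2 : ℝ) • v
  rw [h3, h4, h5, two_smul]

variable (E) in
/-- On a Lie group there is a size function, defining the neighbourhoods of `1`, for which squaring
is injective, expanding and locally surjective near `1`. -/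
lemma exists_size [FiniteDimensional ℝ E] (G : Type*) [TopologicalSpace G] [ChartedSpace E G]
    [Group G] [LieGroup 𝓘(ℝ, E) ∞ G] :
    ∃ (ν : G → ℝ) (r : ℝ), 0 < r ∧ (∀ g, 0 ≤ ν g) ∧ (∀ g, ν g = 0 → g = 1) ∧
      (𝓝 (1 : G)).HasBasis (fun ε : ℝ => 0 < ε) (fun ε => {g | ν g < ε}) ∧
      InjOn (fun g : G => g * g) {g | ν g < r} ∧
      (∀ g, ν g < r → 3 / 2 * ν g ≤ ν (g * g)) ∧
      ∀ g, ν g < r → ∃ s, s * s = g ∧ ν s ≤ 2 / 3 * ν g := by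
  classical
  have hG : IsTopologicalGroup G := topologicalGroup_of_lieGroup 𝓘(ℝ, E) ∞
  have hd := hasStrictFDerivAt_chartSq E G
  set φ := extChartAt 𝓘(ℝ, E) (1 : G)
  set e := φ 1
  have hsymm : φ.symm e = 1 := extChartAt_to_inv (I := 𝓘(ℝ, E)) (1 : G)
  have h1s : (1 : G) ∈ φ.source := mem_extChartAt_source (I := 𝓘(ℝ, E)) (1 : G)
  have hfe : chartSq E G e = e := by
    change φ (φ.symm e * φ.symm e) = e
    rw [hsymm, mul_one]
  have hcs : ContinuousAt φ.symm e := continuousAt_extChartAt_symm (I := 𝓘(ℝ, E)) (1 : G)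
  have hmap : map (chartSq E G) (𝓝 e) = 𝓝 e := by
    have := hd.map_nhds_eq_of_equiv
    rwa [hfe] at this
  -- a radius on which the derivative estimate holds and the products stay in the chart
  obtain ⟨r, hr, hest, htgt, hprod⟩ : ∃ r > 0,
      (∀ x ∈ Metric.ball e r, ∀ y ∈ Metric.ball e r,
        ‖chartSq E G x - chartSq E G y - (2 : ℝ) • (x - y)‖ ≤ 1 / 2 * ‖x - y‖) ∧
      Metric.ball e r ⊆ φ.target ∧
      ∀ x ∈ Metric.ball e r, φ.symm x * φ.symm x ∈ φ.source := by
    have h1 := hd.isLittleO.def (c := 1 / 2) (by norm_num)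
    rw [nhds_prod_eq] at h1
    obtain ⟨p, hp, hp'⟩ := (eventually_prod_self_iff (r := fun x y =>
      ‖chartSq E G x - chartSq E G y - (2 : ℝ) • (x - y)‖ ≤ 1 / 2 * ‖x - y‖)).1 h1
    have h2 : φ.target ∈ 𝓝 e := extChartAt_target_mem_nhds (I := 𝓘(ℝ, E)) (1 : G)
    have h3 : ∀ᶠ x in 𝓝 e, φ.symm x * φ.symm x ∈ φ.source := by
      refine (hcs.mul hcs).eventually_mem ?_
      rw [Pi.mul_apply, hsymm, mul_one]
      exact extChartAt_source_mem_nhds (I := 𝓘(ℝ, E)) (1 : G)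
    obtain ⟨r, hr, hb⟩ := Metric.eventually_nhds_iff_ball.1 ((eventually_mem_set.2 hp).and
      ((eventually_mem_set.2 h2).and h3))
    exact ⟨r, hr, fun x hx y hy => hp' x (hb x hx).1 y (hb y hy).1, fun x hx => (hb x hx).2.1,
      fun x hx => (hb x hx).2.2⟩
  -- The constant is `3 / 2 = 2 - 1 / 2`: the derivative doubles distances and the error is at most
  -- half the distance.
  have hexp : ∀ x ∈ Metric.ball e r, ∀ y ∈ Metric.ball e r,
      3 / 2 * ‖x - y‖ ≤ ‖chartSq E G x - chartSq E G y‖ := by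
    intro x hx y hy
    have h1 := hest x hx y hy
    have h2 : ‖(2 : ℝ) • (x - y)‖ = 2 * ‖x - y‖ := by simp [norm_smul]
    have h3 := norm_sub_norm_le ((2 : ℝ) • (x - y)) (chartSq E G x - chartSq E G y)
    rw [norm_sub_rev ((2 : ℝ) • (x - y))] at h3
    linarith
  -- By the inverse function theorem squaring maps neighbourhoods of `e` onto neighbourhoods of `e`,
  -- so all points within some `r'` have a square root within `r`.
  obtain ⟨r', hr', hroot⟩ : ∃ r' > 0, Metric.ball e r' ⊆ chartSq E G '' Metric.ball e r := by
    refine Metric.mem_nhds_iff.1 ?_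
    rw [← hmap]
    exact image_mem_map (Metric.ball_mem_nhds e hr)
  have her : e ∈ Metric.ball e r := Metric.mem_ball_self hr
  let R : ℝ := min r r'
  -- The size is the distance to `e` in the chart. Outside the chart it has the default value `R`,
  -- so that `ν g < R` forces `g` into the chart.
  let ν : G → ℝ := fun g => if g ∈ φ.source then ‖φ g - e‖ else R
  have hR : 0 < R := lt_min hr hr'
  have hν : ∀ g, ν g < R → g ∈ φ.source ∧ ν g = ‖φ g - e‖ := by
    intro g hg
    by_cases h : g ∈ φ.source
    · exact ⟨h, if_pos h⟩
    · simp [ν, h] at hg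
  have hν' : ∀ g ∈ φ.source, ν g = ‖φ g - e‖ := fun g hg => if_pos hg
  have hball : ∀ g, ν g < R → φ g ∈ Metric.ball e r := fun g hg => by
    rw [mem_ball_iff_norm, ← (hν g hg).2]
    exact hg.trans_le (min_le_left _ _)
  have hsq : ∀ g, ν g < R → chartSq E G (φ g) = φ (g * g) ∧ g * g ∈ φ.source := fun g hg => by
    have h1 := φ.left_inv (hν g hg).1
    have h2 := hprod _ (hball g hg)
    rw [h1] at h2
    refine ⟨?_, h2⟩
    change φ (φ.symm (φ g) * φ.symm (φ g)) = _
    rw [h1]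
  refine ⟨ν, R, hR, fun g => ?_, fun g hg => ?_, ⟨fun V => ⟨fun hV => ?_, ?_⟩⟩, ?_, fun g hg => ?_,
    fun g hg => ?_⟩
  · by_cases h : g ∈ φ.source
    · rw [hν' g h]; exact norm_nonneg _
    · simp only [ν, h, if_false]; exact hR.le
  · obtain ⟨h1, h2⟩ := hν g (hg ▸ hR)
    rw [hg, eq_comm, norm_eq_zero, sub_eq_zero] at h2
    exact φ.injOn h1 h1s h2
  · have h1 : φ.symm ⁻¹' V ∈ 𝓝 e := hcs (by rwa [hsymm])
    obtain ⟨ε, hε, hb⟩ := Metric.mem_nhds_iff.1 h1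
    refine ⟨min ε R, lt_min hε hR, fun g (hg : ν g < min ε R) => ?_⟩
    obtain ⟨h2, h3⟩ := hν g (hg.trans_le (min_le_right _ _))
    have h4 : φ g ∈ Metric.ball e ε := by
      rw [mem_ball_iff_norm, ← h3]
      exact hg.trans_le (min_le_left _ _)
    have h5 := hb h4
    rwa [mem_preimage, φ.left_inv h2] at h5
  · rintro ⟨ε, hε, hV⟩
    refine mem_of_superset ?_ hV
    have h1 : φ ⁻¹' Metric.ball e ε ∈ 𝓝 (1 : G) :=
      (continuousAt_extChartAt (I := 𝓘(ℝ, E)) (1 : G)) (Metric.ball_mem_nhds e hε)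
    filter_upwards [h1, extChartAt_source_mem_nhds (I := 𝓘(ℝ, E)) (1 : G)] with g hg hg'
    rw [hν' g hg', ← mem_ball_iff_norm]
    exact hg
  · intro g hg g' hg' h
    have h1 := hexp _ (hball g hg) _ (hball g' hg')
    rw [(hsq g hg).1, (hsq g' hg').1, show g * g = g' * g' from h, sub_self, norm_zero] at h1
    have h2 : ‖φ g - φ g'‖ = 0 := le_antisymm (by linarith) (norm_nonneg _)
    exact φ.injOn (hν g hg).1 (hν g' hg').1 (sub_eq_zero.1 (norm_eq_zero.1 h2))
  · have h1 := hexp _ (hball g hg) _ her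
    rwa [hfe, (hsq g hg).1, ← (hν g hg).2, ← hν' _ (hsq g hg).2] at h1
  · have h0 : φ g ∈ Metric.ball e r' := by
      rw [mem_ball_iff_norm, ← (hν g hg).2]
      exact hg.trans_le (min_le_right _ _)
    obtain ⟨x, hx, hxg⟩ := hroot h0
    have hxs : φ.symm x ∈ φ.source := φ.map_target (htgt hx)
    -- The square of the root and `g` have the same chart coordinate and both lie in the chart
    -- domain. The bound `2 / 3` is the expansion estimate between `x` and `e`, read backwards.
    refine ⟨φ.symm x, φ.injOn (hprod x hx) (hν g hg).1 hxg, ?_⟩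
    have h1 := hexp x hx e her
    rw [hfe, hxg, ← (hν g hg).2] at h1
    rw [hν' _ hxs, φ.right_inv (htgt hx)]
    linarith

end LieSquaring

/-! ### The Weyl group is finite -/

section WeylFinite

variable {G : Type w} [TopologicalSpace G] [Group G] [IsTopologicalGroup G]

/-- The tube lemma. It is applied to conjugation and to the commutator, which are trivial when their
first argument `v` is `1`. -/
lemma exists_nhds_forall_mem_of_compact [CompactSpace G] (f : G → G → G)
    (hf : Continuous fun p : G × G => f p.1 p.2) (h1 : ∀ h, f 1 h = 1) {U : Set G}
    (hU : U ∈ 𝓝 (1 : G)) : ∃ V ∈ 𝓝 (1 : G), ∀ v ∈ V, ∀ h, f v h ∈ U := by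
  have h : ∀ᶠ v in 𝓝 (1 : G), ∀ h ∈ (univ : Set G), f v h ∈ U := by
    refine isCompact_univ.eventually_forall_of_forall_eventually fun h _ => ?_
    refine hf.continuousAt.eventually_mem ?_
    simpa [h1] using hU
  exact ⟨_, h, fun v hv h => hv h (mem_univ h)⟩

/-- A closed subgroup of a compact group, topologically generated by a connected subgroup and
the members of a sequence of successive square roots tending to `1`, is connected. -/
lemma isConnected_topologicalClosure_of_roots [CompactSpace G] [T2Space G] {T : Subgroup G}
    (hT : IsConnected (T : Set G)) {s : ℕ → G} (hs : ∀ j, s (j + 1) * s (j + 1) = s j)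
    (hlim : Tendsto s atTop (𝓝 1)) :
    IsConnected ((Subgroup.closure (T ∪ range s)).topologicalClosure : Set G) := by
  set K := (Subgroup.closure (T ∪ range s)).topologicalClosure
  have hKc : IsClosed (K : Set G) := Subgroup.isClosed_topologicalClosure _
  have hsub : (T ∪ range s : Set G) ⊆ K :=
    Subgroup.subset_closure.trans (Subgroup.le_topologicalClosure _)
  have : CompactSpace K := isCompact_iff_compactSpace.1 hKc.isCompact
  have : PreconnectedSpace T := isPreconnected_iff_preconnectedSpace.1 hT.isPreconnected
  -- It is enough that `K` has no proper open subgroup, since a clopen neighbourhood of `1` in a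
  -- compact group contains an open subgroup.
  have hopen : ∀ O : OpenSubgroup K, (O : Set K) = univ := by
    intro O
    let O' : Subgroup G := (O : Subgroup K).map K.subtype
    have hO' : ∀ x (hx : x ∈ K), (⟨x, hx⟩ : K) ∈ O → x ∈ O' := fun x hx h => ⟨⟨x, hx⟩, h, rfl⟩
    have hTO : (T : Set G) ⊆ O' := by
      let i : T → K := fun t => ⟨t, hsub (Or.inl t.2)⟩
      have hi : Continuous i := continuous_subtype_val.subtype_mk _
      -- An open subgroup is clopen, so it contains the connected `T`.
      have h1 : i ⁻¹' (O : Set K) = univ :=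
        IsClopen.eq_univ (O.isClopen.preimage hi) ⟨1, O.one_mem⟩
      intro t ht
      exact hO' t _ (h1.ge (mem_univ (⟨t, ht⟩ : T)))
    have hsO : ∀ j, s j ∈ O' := by
      let σ : ℕ → K := fun j => ⟨s j, hsub (Or.inr ⟨j, rfl⟩)⟩
      have h1 : Tendsto σ atTop (𝓝 1) := tendsto_subtype_rng.2 hlim
      obtain ⟨J, hJ⟩ := eventually_atTop.1 (h1.eventually_mem O.mem_nhds_one)
      -- The tail of the sequence lies in `O`; squaring `d` times carries membership back to the
      -- earlier terms.
      have h2 : ∀ d j, s (j + d) ∈ O' → s j ∈ O' := by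
        intro d
        induction d with
        | zero => exact fun j h => h
        | succ d ih => exact fun j h => ih j (hs (j + d) ▸ O'.mul_mem h h)
      exact fun j => h2 J j (hO' _ _ (hJ (j + J) (Nat.le_add_left _ _)))
    have hcl : IsClosed (O' : Set G) := by
      exact hKc.isClosedEmbedding_subtypeVal.isClosedMap _ O.isClosed
    have hle : K ≤ O' := Subgroup.topologicalClosure_minimal _
      ((Subgroup.closure_le _).2 (union_subset hTO (range_subset_iff.2 hsO))) hcl
    refine eq_univ_of_forall fun x => ?_
    obtain ⟨y, hy, hyx⟩ := hle x.2
    rwa [← Subtype.ext hyx]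
  refine ⟨⟨1, K.one_mem⟩, isPreconnected_iff_preconnectedSpace.2 ?_⟩
  refine (preconnectedSpace_iff_clopen (α := K)).2 fun C hC => ?_
  -- Either `C` or its complement contains `1`, and that one is all of `K`.
  by_cases h1 : (1 : K) ∈ C
  · obtain ⟨O, hO⟩ := IsTopologicalGroup.exist_openSubgroup_sub_clopen_nhds_of_one hC h1
    exact Or.inr (univ_subset_iff.1 ((hopen O).ge.trans hO))
  · obtain ⟨O, hO⟩ := IsTopologicalGroup.exist_openSubgroup_sub_clopen_nhds_of_one hC.compl h1
    exact Or.inl (compl_univ_iff.1 (univ_subset_iff.1 ((hopen O).ge.trans hO)))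

lemma commute_topologicalClosure [T2Space G] {k : Set G}
    (hk : ∀ x ∈ k, ∀ y ∈ k, x * y = y * x) :
    ∀ x ∈ (Subgroup.closure k).topologicalClosure,
      ∀ y ∈ (Subgroup.closure k).topologicalClosure, x * y = y * x := by
  have := Subgroup.isMulCommutative_closure hk
  let := (Subgroup.closure k).commGroupTopologicalClosure fun x y => mul_comm' x y
  intro x hx y hy
  exact congrArg Subtype.val (mul_comm (⟨x, hx⟩ : (Subgroup.closure k).topologicalClosure) ⟨y, hy⟩)

/-- Both conjugates of each `t` are required to lie in `T`: the condition on `g * t * g⁻¹` alone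
says only that conjugation by `g` maps `T` into itself. -/
lemma isClosed_normalizer {T : Subgroup G} (hT : IsClosed (T : Set G)) :
    IsClosed (Subgroup.normalizer (T : Set G) : Set G) := by
  have : (Subgroup.normalizer (T : Set G) : Set G) =
      ⋂ t ∈ T, {g | g * t * g⁻¹ ∈ T} ∩ {g | g⁻¹ * t * g ∈ T} := by
    ext g
    simp only [SetLike.mem_coe, mem_iInter, mem_inter_iff, mem_ofPred_eq]
    refine ⟨fun hg t ht => ⟨(Subgroup.mem_normalizer_iff.1 hg t).1 ht,
      (Subgroup.mem_normalizer_iff''.1 hg t).1 ht⟩, fun h => ?_⟩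
    refine Subgroup.mem_normalizer_iff.2 fun t => ⟨fun ht => (h t ht).1, fun ht => ?_⟩
    simpa [mul_assoc] using (h _ ht).2
  rw [this]
  refine isClosed_biInter fun t _ => IsClosed.inter ?_ ?_
  · exact hT.preimage (f := fun g : G => g * t * g⁻¹) (by fun_prop)
  · exact hT.preimage (f := fun g : G => g⁻¹ * t * g) (by fun_prop)

/-- A Lie group has no small subgroups. -/
lemma exists_nhds_no_subgroup (E : Type*) [NormedAddCommGroup E] [NormedSpace ℝ E]
    [FiniteDimensional ℝ E] (G : Type*) [TopologicalSpace G] [ChartedSpace E G] [Group G]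
    [LieGroup 𝓘(ℝ, E) ∞ G] :
    ∃ U ∈ 𝓝 (1 : G), ∀ H : Subgroup G, (H : Set G) ⊆ U → H = ⊥ := by
  obtain ⟨ν, r, hr, hν0, hν1, hb, -, hexp, -⟩ := exists_size E G
  refine ⟨_, hb.mem_of_mem hr, fun H hH => (Subgroup.eq_bot_iff_forall H).2 fun h hh => ?_⟩
  -- All powers of `h` stay where squaring expands, so the size of `h ^ 2 ^ k` grows geometrically
  -- while remaining below `r`; this forces `ν h = 0`.
  have h1 : ∀ k : ℕ, (3 / 2 : ℝ) ^ k * ν h ≤ ν (h ^ 2 ^ k) := by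
    intro k
    induction k with
    | zero => simp
    | succ k ih =>
      have h2 := hexp (h ^ 2 ^ k) (hH (H.pow_mem hh _))
      rw [pow_succ 2, mul_comm (2 ^ k), pow_mul', sq, pow_succ]
      linarith
  refine hν1 h (le_antisymm (not_lt.1 fun hpos => ?_) (hν0 h))
  obtain ⟨k, hk⟩ := pow_unbounded_of_one_lt (r / ν h) (show (1 : ℝ) < 3 / 2 by norm_num)
  have h2 : ν (h ^ 2 ^ k) < r := hH (H.pow_mem hh _)
  rw [div_lt_iff₀ hpos] at hk
  linarith [h1 k]

/-- Elements near `1` of the centralizer of a maximal torus belong to it. -/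
lemma IsMaximalTorus.eventually_mem_of_commute (E : Type*) [NormedAddCommGroup E] [NormedSpace ℝ E]
    [FiniteDimensional ℝ E] [T2Space G] [ChartedSpace E G] [LieGroup 𝓘(ℝ, E) ∞ G] [CompactSpace G]
    {T : Subgroup G} (hT : IsMaximalTorus T) :
    ∀ᶠ g in 𝓝 (1 : G), (∀ t ∈ T, t * g = g * t) → g ∈ T := by
  obtain ⟨ν, r, hr, hν0, -, hb, hinj, -, hroot⟩ := exists_size E G
  -- Every conjugate of an element of `V` has size below `r`, so uniqueness of small square roots
  -- applies to conjugates of roots.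
  obtain ⟨V, hV, hVU⟩ := exists_nhds_forall_mem_of_compact (fun v h : G => h * v * h⁻¹)
    (by fun_prop) (by simp) (hb.mem_of_mem hr)
  obtain ⟨ε, hε, hεV⟩ := hb.mem_iff.1 hV
  filter_upwards [hb.mem_of_mem (lt_min hε hr)] with g hg hcomm
  -- Roots are smaller than the elements they come from, so root extraction maps this ball to itself
  -- and can be iterated.
  have hex : ∀ x : {x : G // ν x < min ε r}, ∃ y : {x : G // ν x < min ε r},
      (y : G) * y = x ∧ ν y ≤ 2 / 3 * ν x := by
    rintro ⟨x, hx⟩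
    obtain ⟨y, hy, hyx⟩ := hroot x (hx.trans_le (min_le_right _ _))
    exact ⟨⟨y, by linarith [hν0 x]⟩, hy, hyx⟩
  choose ρ hρ hρν using hex
  let s : ℕ → {x : G // ν x < min ε r} := fun j => ρ^[j] ⟨g, hg⟩
  have hs1 : ∀ j, s (j + 1) = ρ (s j) := fun j => Function.iterate_succ_apply' ρ j _
  have hs : ∀ j, (s (j + 1) : G) * s (j + 1) = s j := fun j => by rw [hs1, hρ]
  have hsν : ∀ j, ν (s j) ≤ (2 / 3) ^ j * ν g := by
    intro j
    induction j with
    | zero => simp [s]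
    | succ j ih =>
      rw [hs1, pow_succ]
      linarith [hρν (s j)]
  have hlim : Tendsto (fun j => (s j : G)) atTop (𝓝 1) := by
    refine hb.tendsto_right_iff.2 fun δ hδ => ?_
    have h1 : Tendsto (fun j : ℕ => (2 / 3 : ℝ) ^ j * ν g) atTop (𝓝 (0 * ν g)) :=
      (tendsto_pow_atTop_nhds_zero_of_lt_one (by norm_num) (by norm_num)).mul_const _
    rw [zero_mul] at h1
    filter_upwards [h1.eventually_lt_const hδ] with j hj
    exact (hsν j).trans_lt hj
  -- If `h` commutes with `s j`, then `s (j + 1)` and its conjugate by `h` are two small square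
  -- roots of `s j`, hence equal.
  have hstep : ∀ (h : G) (j : ℕ), h * s j = s j * h → h * s (j + 1) = s (j + 1) * h := by
    intro h j hj
    have h1 : ν (s (j + 1)) < r := (s (j + 1)).2.trans_le (min_le_right _ _)
    have h2 : ν (h * s (j + 1) * h⁻¹) < r :=
      hVU _ (hεV ((s (j + 1)).2.trans_le (min_le_left _ _))) h
    have h3 := hinj h2 h1 (by
      change h * s (j + 1) * h⁻¹ * (h * s (j + 1) * h⁻¹) = (s (j + 1) : G) * s (j + 1)
      rw [hs j, ← mul_inv_eq_iff_eq_mul.2 hj, ← hs j]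
      group)
    exact mul_inv_eq_iff_eq_mul.1 h3
  have hTs : ∀ t ∈ T, ∀ j, t * s j = s j * t := by
    intro t ht j
    induction j with
    | zero => exact hcomm t ht
    | succ j ih => exact hstep t j ih
  have hss : ∀ i k, (s i : G) * s (i + k) = s (i + k) * s i := by
    intro i k
    induction k with
    | zero => rfl
    | succ k ih => exact hstep _ _ ih
  have hss' : ∀ i j, (s i : G) * s j = s j * s i := by
    intro i j
    rcases le_total i j with h | h
    · obtain ⟨k, rfl⟩ := Nat.exists_eq_add_of_le h
      exact hss i k
    · obtain ⟨k, rfl⟩ := Nat.exists_eq_add_of_le h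
      exact (hss j k).symm
  set K := (Subgroup.closure ((T : Set G) ∪ range fun j => (s j : G))).topologicalClosure
  have hsub : ((T : Set G) ∪ range fun j => (s j : G)) ⊆ K :=
    Subgroup.subset_closure.trans (Subgroup.le_topologicalClosure _)
  have hK : IsTorus K := by
    refine ⟨Subgroup.isClosed_topologicalClosure _,
      isConnected_topologicalClosure_of_roots hT.1.2.1 hs hlim, commute_topologicalClosure ?_⟩
    rintro x (hx | ⟨i, rfl⟩) y (hy | ⟨j, rfl⟩)
    · exact hT.1.2.2 x hx y hy
    · exact hTs x hx j
    · exact (hTs y hy i).symm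
    · exact hss' i j
  -- The torus `K` contains `T`, so `K ≤ T` by maximality, and `g` is the term `s 0` of `K`.
  exact hT.2 hK (fun t ht => hsub (Or.inl ht)) (hsub (Or.inr ⟨0, rfl⟩))

/-- Elements near `1` of the normalizer of a torus centralize it. -/
lemma IsTorus.eventually_commute (E : Type*) [NormedAddCommGroup E] [NormedSpace ℝ E]
    [FiniteDimensional ℝ E] [ChartedSpace E G] [LieGroup 𝓘(ℝ, E) ∞ G] [CompactSpace G]
    {T : Subgroup G} (hT : IsTorus T) :
    ∀ᶠ g in 𝓝 (1 : G), g ∈ Subgroup.normalizer (T : Set G) → ∀ t ∈ T, t * g = g * t := by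
  obtain ⟨U, hU, hsmall⟩ := exists_nhds_no_subgroup E G
  -- For `v` in `V`, all commutators of `v` with elements of `G` lie in `U`, uniformly in the second
  -- element.
  obtain ⟨V, hV, hVU⟩ := exists_nhds_forall_mem_of_compact (fun v h : G => v * h * v⁻¹ * h⁻¹)
    (by fun_prop) (by simp) hU
  filter_upwards [hV] with g hg hgN t ht
  have hconj : ∀ t ∈ T, g * t * g⁻¹ ∈ T := fun t ht => (Subgroup.mem_normalizer_iff.1 hgN t).1 ht
  -- The map `t ↦ g t g⁻¹ t⁻¹` is multiplicative because `g` normalizes `T` and `T` is abelian. Its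
  -- range is then a subgroup inside `U`, hence trivial.
  let f : T →* G :=
    { toFun := fun t => g * t * g⁻¹ * (t : G)⁻¹
      map_one' := by simp
      map_mul' := fun a b => by
        have h1 := hT.2.2 _ (hconj b b.2) _ (T.inv_mem a.2)
        calc g * ((a * b : T) : G) * g⁻¹ * ((a * b : T) : G)⁻¹
            = g * a * g⁻¹ * ((g * b * g⁻¹) * ((b : G)⁻¹ * (a : G)⁻¹)) := by
              push_cast; group
          _ = g * a * g⁻¹ * ((g * b * g⁻¹) * ((a : G)⁻¹ * (b : G)⁻¹)) := by
              rw [hT.2.2 _ (T.inv_mem b.2) _ (T.inv_mem a.2)]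
          _ = g * a * g⁻¹ * (((g * b * g⁻¹) * (a : G)⁻¹) * (b : G)⁻¹) := by group
          _ = g * a * g⁻¹ * (a : G)⁻¹ * (g * b * g⁻¹ * (b : G)⁻¹) := by rw [h1]; group }
  have hf : f.range = ⊥ := hsmall _ (by rintro _ ⟨t, rfl⟩; exact hVU g hg t)
  have h1 : f ⟨t, ht⟩ = 1 := Subgroup.mem_bot.1 (hf.le ⟨_, rfl⟩)
  have h2 : g * t * g⁻¹ * t⁻¹ = 1 := h1
  exact (mul_inv_eq_iff_eq_mul.1 (mul_inv_eq_one.1 h2)).symm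

/-- The Weyl group of a maximal torus of a compact Lie group is finite. -/
lemma IsMaximalTorus.finite_weylGroup (E : Type*) [NormedAddCommGroup E] [NormedSpace ℝ E]
    [FiniteDimensional ℝ E] [T2Space G] [ChartedSpace E G] [LieGroup 𝓘(ℝ, E) ∞ G] [CompactSpace G]
    {T : Subgroup G} (hT : IsMaximalTorus T) :
    Finite (WeylGroup T) := by
  have : CompactSpace (Subgroup.normalizer (T : Set G)) :=
    isCompact_iff_compactSpace.1 (isClosed_normalizer hT.1.1).isCompact
  -- A compact group has finite quotient by an open subgroup, and a subgroup is open once it is a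
  -- neighbourhood of `1`.
  refine Subgroup.quotient_finite_of_isOpen _ (Subgroup.isOpen_of_mem_nhds _ (g := 1) ?_)
  have h1 := (hT.eventually_mem_of_commute E).and (hT.1.eventually_commute E)
  have h2 : Tendsto (fun g : Subgroup.normalizer (T : Set G) => (g : G)) (𝓝 1) (𝓝 1) :=
    continuous_subtype_val.tendsto 1
  filter_upwards [h2.eventually h1] with g hg
  exact Subgroup.mem_subgroupOf.2 (hg.1 (hg.2 g.2))

end WeylFinite

end BredonRational

end

/-! ### The universal cover with its action of `π₁(Y) ⋊ W`. -/

theorem mainTheorem9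
    {E : Type*} [NormedAddCommGroup E] [NormedSpace ℝ E] [FiniteDimensional ℝ E]
    {G : Type*} [TopologicalSpace G] [T2Space G] [ChartedSpace E G] [Group G]
    [IsTopologicalGroup G] [LieGroup 𝓘(ℝ, E) ∞ G] [CompactSpace G] [ConnectedSpace G]
    (T : Subgroup G) (hT : BredonRational.IsMaximalTorus T)
    {Y : Type*} [TopologicalSpace Y] [T2Space Y] [PathConnectedSpace Y]
    [MulAction (BredonRational.WeylGroup T) Y] [ContinuousConstSMul (BredonRational.WeylGroup T) Y]
    [Topology.CWComplex (Set.univ : Set Y)]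
    [∀ n, MulAction (BredonRational.WeylGroup T)
      (Topology.RelCWComplex.cell (Set.univ : Set Y) n)]
    [BredonRational.EquivariantCW (BredonRational.WeylGroup T) Y]
    [BredonRational.EquivariantFiniteType (BredonRational.WeylGroup T) Y]
    (y₀ : MulAction.fixedPoints (BredonRational.WeylGroup T) Y)
    (φ : BredonRational.PiOne (y₀ : Y) →* (T →ₜ* Circle))
    (hφ : ∀ (w : BredonRational.WeylGroup T) (a : BredonRational.PiOne (y₀ : Y)),
      φ (BredonRational.piOneAct y₀ w a) = BredonRational.weylChar T w (φ a))
    (n : ℕ) :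
    Nonempty
      (BredonRational.BredonH (BredonRational.coverFiltration Y y₀)
          (BredonRational.fixedCoeff
            (BredonRational.twistedRep T (BredonRational.piOneAct y₀) φ hφ)) n
        ≃ₗ[BredonRational.RepRingQ G]
      Representation.invariants
        (BredonRational.quotientRep (BredonRational.coverFiltration Y y₀)
          (BredonRational.UnivCover.inl_smul y₀)
          (BredonRational.twistedRep T (BredonRational.piOneAct y₀) φ hφ) n)) := by
  have := hT.finite_weylGroup E
  let := Fintype.ofFinite (BredonRational.WeylGroup T)
  -- The order of `W` is a nonzero rational number, hence a unit in the `ℚ`-algebra `R(G)_ℚ`. This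
  -- is where rational coefficients enter.
  let : Invertible (Fintype.card (BredonRational.WeylGroup T) : BredonRational.RepRingQ G) :=
    ((IsUnit.mk0 (Fintype.card (BredonRational.WeylGroup T) : ℚ)
      (Nat.cast_ne_zero.2 Fintype.card_ne_zero)).map
        (algebraMap ℚ (BredonRational.RepRingQ G))).invertible.copy _ (map_natCast _ _).symm
  exact ⟨BredonRational.bredonHEquivInvariants _ _ _ n⟩
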